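/- Let $n\ge 1$ be an integer, let $p>2$ be a prime with $p\nmid n$, and let $q=p^r$ with $r\ge 1$. Let $\mathbb{Q}_q\subset\mathbb{C}_p$ be the unramified extension of $\mathbb{Q}_p$ of degree $r$, $\mathbb{Z}_q$ its ring of integers, with residue field $\mathbb{F}_q$. Let $\zeta_p\in\mathbb{C}_p$ be a primitive $p$-th root of unity and let $\gamma\in\mathbb{Q}_p(\zeta_p)$ satisfy $\sum_{k\ge 0}\gamma^{p^k}/p^k=0$ and $\mathrm{ord}_p(\gamma)=\frac1{p-1}$. Let $\tilde\gamma\in\mathbb{C}_p$ satisfy $\tilde\gamma^n=\gamma$. Let $t\in\mathbb{F}_q^*$ with Teichmüller lift $\bar t\in\mathbb{Z}_q$. For $(a,b)\in\mathbb{Z}^2$ put $$\omega(a,b)=\frac an+b+\frac{2n+1}{n}\max\{0,-a,-b\}\in\tfrac1n\mathbb{Z}_{\ge 0},$$ and let $$\mathcal{C}_0=\Big\{\sum_{(a,b)\in\mathbb{Z}^2}\xi(a,b)\,\tilde\gamma^{\,n\omega(a,b)}x^ay^b \;:\; \xi(a,b)\in\mathbb{Z}_q[\tilde\gamma],\ |\xi(a,b)|_p\to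 0\text{ as }\omega(a,b)\to\infty\Big\}.$$ With $\gamma_i=\sum_{k=0}^{i}\gamma^{p^k}/p^k$, let $$D_x=x\frac{\partial}{\partial x}+\sum_{i\ge 0}\gamma_ip^i\Big(nx^{np^i}-\frac{\bar t^{\,p^i}}{x^{p^i}y^{p^i}}\Big),\qquad D_y=y\frac{\partial}{\partial y}+\sum_{i\ge 0}\gamma_ip^i\Big(y^{p^i}-\frac{\bar t^{\,p^i}}{x^{p^i}y^{p^i}}\Big).$$ These are well-defined $\mathbb{Z}_q[\tilde\gamma]$-linear operators on $\mathcal{C}_0$, and they define a complex $(\Omega^\bullet_{\mathcal{C}_0},\nabla(D))$: $$\mathcal{C}_0\to\mathcal{C}_0\tfrac{dx}{x}\oplus\mathcal{C}_0\tfrac{dy}{y}\to\mathcal{C}_0\tfrac{dx}{x}\wedge\tfrac{dy}{y},\qquad \xi\mapsto D_x\xi\,\tfrac{dx}{x}+D_y\xi\,\tfrac{dy}{y},\quad \xi_1\tfrac{dx}{x}+\xi_2\tfrac{dy}{y}\mapsto(D_x\xi_2-D_y\xi_1)\tfrac{dx}{x}\wedge\tfrac{dy}{y}.$$ Let $\varepsilon_i=x^i$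 for $0\le i\le n$, $\varepsilon_i=x^{i-n}y$ for $n+1\le i\le 2n$, and $\tilde\varepsilon_i=\tilde\gamma^{\,n\omega(\varepsilon_i)}\varepsilon_i$, where $\omega(\varepsilon_i)$ is the weight of the exponent of $\varepsilon_i$. Then the classes of $\tilde\varepsilon_i$, $0\le i\le 2n$, form a basis of the $\mathbb{Z}_q[\tilde\gamma]$-module $H^2(\Omega^\bullet_{\mathcal{C}_0},\nabla(D))$. More precisely, $$\mathcal{C}_0=\bigoplus_{i=0}^{2n}\mathbb{Z}_q[\tilde\gamma]\,\tilde\varepsilon_i\;\oplus\;(D_x\mathcal{C}_0+D_y\mathcal{C}_0).$$ -/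

import Mathlib

open Filter Topology

noncomputable section

namespace DworkCohomology

/-! ### The weight function -/

/-- `m(a,b) = max {0, -a, -b}`. -/
def mMax (u : ℤ × ℤ) : ℤ := max 0 (max (-u.1) (-u.2))

/-- The weight function `ω(a,b) = a/n + b + ((2n+1)/n) m(a,b)` of the triangle with vertices
`(-1,-1)`, `(n,0)`, `(0,1)`. -/
def omega (n : ℕ) (u : ℤ × ℤ) : ℚ :=
  (u.1 : ℚ) / n + u.2 + ((2 * n + 1 : ℚ) / n) * mMax u

/-- The non-negative integer `n ω(a,b)`, see `natCast_wt`. -/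
def wt (n : ℕ) (u : ℤ × ℤ) : ℕ := (u.1 + n * u.2 + (2 * n + 1) * mMax u).toNat

theorem natCast_wt (n : ℕ) (hn : 0 < n) (u : ℤ × ℤ) : (wt n u : ℚ) = n * omega n u := by
  have h0 : 0 ≤ u.1 + n * u.2 + (2 * n + 1) * mMax u := by
    have hn' : (0 : ℤ) ≤ n := by positivity
    have h1 : 0 ≤ mMax u := le_max_left _ _
    have h2 : -u.1 ≤ mMax u := le_trans (le_max_left _ _) (le_max_right _ _)
    have h3 : -u.2 ≤ mMax u := le_trans (le_max_right _ _) (le_max_right _ _)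
    nlinarith [mul_nonneg hn' (by linarith : 0 ≤ u.2 + mMax u), mul_nonneg hn' h1]
  have h : ((wt n u : ℤ) : ℚ) = ((u.1 + n * u.2 + (2 * n + 1) * mMax u : ℤ) : ℚ) := by
    rw [wt, Int.toNat_of_nonneg h0]
  have hn' : (n : ℚ) ≠ 0 := by positivity
  rw [Int.cast_natCast] at h
  rw [h, omega]
  push_cast
  field_simp

/-! ### The coefficient rings -/

section Rings

variable (p : ℕ) [Fact p.Prime] (a : ℕ)

/-- `ℚ_q`, `q = p ^ a`: the unramified extension of `ℚ_p` of degree `a` inside `ℂ_p`, generated by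
the `(q-1)`-st roots of unity. -/
def Qq : IntermediateField ℚ_[p] ℂ_[p] :=
  IntermediateField.adjoin ℚ_[p] {z : ℂ_[p] | z ^ (p ^ a - 1) = 1}

/-- `ℤ_q`: the ring of integers of `ℚ_q`, i.e. its elements of norm at most `1`. -/
def Zq : ValuationSubring (Qq p a) :=
  (NormedField.valuation (K := ℂ_[p])).valuationSubring.comap (algebraMap (Qq p a) ℂ_[p])

/-- `𝔽_q`: the residue field of `ℤ_q`. -/
abbrev Fq : Type := IsLocalRing.ResidueField (Zq p a)

/-- `s` is the Teichmüller lift of `t ∈ 𝔽_q`: it reduces to `t` and `s ^ q = s`. -/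
def IsTeichmuller (t : Fq p a) (s : Zq p a) : Prop :=
  IsLocalRing.residue (Zq p a) s = t ∧ s ^ (p ^ a) = s

/-- The ring `ℤ_q[g]` for `g ∈ ℂ_p`. -/
def ZqAdjoin (g : ℂ_[p]) : Subring ℂ_[p] := (Algebra.adjoin (Zq p a) {g}).toSubring

end Rings

/-! ### The space `C₀`

A formal series `∑ c(a,b) x^a y^b` is represented by its coefficient family `c : ℤ × ℤ → ℂ_p`. -/

section Space

variable (p : ℕ) [Fact p.Prime] (a n : ℕ)

/-- `C₀`: the series `∑ ξ(u) g^{n ω(u)} x^{u.1} y^{u.2}` with `ξ(u) ∈ ℤ_q[g]` and `|ξ(u)| → 0` as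
`ω(u) → ∞`. -/
def C0 (g : ℂ_[p]) : Submodule (ZqAdjoin p a g) (ℤ × ℤ → ℂ_[p]) where
  carrier := {c | ∃ ξ : ℤ × ℤ → ZqAdjoin p a g,
    Tendsto (fun u => ‖(ξ u : ℂ_[p])‖) (comap (omega n) atTop) (𝓝 0) ∧
    ∀ u, c u = (ξ u : ℂ_[p]) * g ^ wt n u}
  zero_mem' := ⟨0, by simpa using tendsto_const_nhds, by simp⟩
  add_mem' := by
    rintro c d ⟨ξ, hξ, hc⟩ ⟨η, hη, hd⟩
    refine ⟨ξ + η, ?_, fun u => ?_⟩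
    · refine squeeze_zero (fun u => norm_nonneg _) (fun u => ?_) (by simpa using hξ.add hη)
      exact norm_add_le _ _
    · simp [hc, hd, add_mul]
  smul_mem' := by
    rintro r c ⟨ξ, hξ, hc⟩
    refine ⟨fun u => r * ξ u, ?_, fun u => ?_⟩
    · have := hξ.const_mul ‖(r : ℂ_[p])‖
      simpa using this
    · simp [hc, mul_assoc, Subring.smul_def]

theorem monomial_mem_C0 (g : ℂ_[p]) (u : ℤ × ℤ) :
    (Pi.single u (g ^ wt n u) : ℤ × ℤ → ℂ_[p]) ∈ C0 p a n g := by
  refine ⟨Pi.single u 1, ?_, fun v => ?_⟩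
  · refine tendsto_const_nhds.congr' ?_
    have h : ∀ᶠ v in comap (omega n) atTop, omega n u < omega n v :=
      tendsto_comap.eventually (eventually_gt_atTop (omega n u))
    filter_upwards [h] with v hv
    have hvu : v ≠ u := by rintro rfl; exact lt_irrefl _ hv
    simp [Pi.single_eq_of_ne hvu]
  · by_cases hvu : v = u
    · subst hvu; simp
    · simp [Pi.single_eq_of_ne hvu]

/-- The exponent of `ε_i`: `x^i` for `0 ≤ i ≤ n` and `x^{i-n} y` for `n + 1 ≤ i ≤ 2n`. -/
def epsExp (i : ℕ) : ℤ × ℤ := if i ≤ n then ((i : ℤ), 0) else ((i : ℤ) - n, 1)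

/-- `ε̃_i = g^{n ω(ε_i)} ε_i ∈ C₀`, for `0 ≤ i ≤ 2n`. -/
def epsTilde (g : ℂ_[p]) (i : Fin (2 * n + 1)) : C0 p a n g :=
  ⟨Pi.single (epsExp n i) (g ^ wt n (epsExp n i)), monomial_mem_C0 p a n g _⟩

end Space

/-! ### The differential operators -/

section Operators

variable (p : ℕ) [Fact p.Prime] (n : ℕ)

/-- `γ_i = ∑_{k=0}^{i} γ^{p^k} / p^k`. -/
def gammaSeq (γ : ℂ_[p]) (i : ℕ) : ℂ_[p] :=
  ∑ k ∈ Finset.range (i + 1), γ ^ p ^ k / (p : ℂ_[p]) ^ k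

/-- `D_x = x ∂/∂x + ∑_i γ_i p^i (n x^{n p^i} - s^{p^i} / (x^{p^i} y^{p^i}))`, coefficientwise. Here
`s` is a Teichmüller lift, so that `s^{p^i}` is its image under the `i`-th power of Frobenius. -/
def Dx (γ s : ℂ_[p]) (c : ℤ × ℤ → ℂ_[p]) : ℤ × ℤ → ℂ_[p] := fun u =>
  (u.1 : ℂ_[p]) * c u + ∑' i : ℕ, gammaSeq p γ i * (p : ℂ_[p]) ^ i *
    ((n : ℂ_[p]) * c (u - ((n * p ^ i : ℤ), (0 : ℤ)))
      - s ^ p ^ i * c (u - (-(p ^ i : ℤ), -(p ^ i : ℤ))))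

/-- `D_y = y ∂/∂y + ∑_i γ_i p^i (y^{p^i} - s^{p^i} / (x^{p^i} y^{p^i}))`, coefficientwise. -/
def Dy (γ s : ℂ_[p]) (c : ℤ × ℤ → ℂ_[p]) : ℤ × ℤ → ℂ_[p] := fun u =>
  (u.2 : ℂ_[p]) * c u + ∑' i : ℕ, gammaSeq p γ i * (p : ℂ_[p]) ^ i *
    (c (u - ((0 : ℤ), (p ^ i : ℤ)))
      - s ^ p ^ i * c (u - (-(p ^ i : ℤ), -(p ^ i : ℤ))))

end Operators

/-! ### The complex `M → M dx/x ⊕ M dy/y → M dx/x ∧ dy/y` -/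

section Complex

variable {R M : Type*} [CommRing R] [AddCommGroup M] [Module R M] (δx δy : M →ₗ[R] M)

/-- `ξ ↦ δx(ξ) dx/x + δy(ξ) dy/y`. -/
def d0 : M →ₗ[R] M × M := δx.prod δy

/-- `ξ₁ dx/x + ξ₂ dy/y ↦ (δx(ξ₂) - δy(ξ₁)) dx/x ∧ dy/y`. -/
def d1 : M × M →ₗ[R] M := δx ∘ₗ LinearMap.snd R M M - δy ∘ₗ LinearMap.fst R M M

/-- The top cohomology: everything in degree two is a cocycle. -/
abbrev H2 : Type _ := M ⧸ LinearMap.range (d1 δx δy)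

end Complex

end DworkCohomology

end

open DworkCohomology

noncomputable section

namespace DworkCohomology

/-! ### The graded Koszul complex

The associated graded ring of `C₀` is `k[x, y, z] / (xyz)`, where `z` stands for `1 / (xy)`. -/

section Graded

open MvPolynomial

variable {k : Type*} [CommRing k]

/-! Write O = ℤ_q[g], where g^n = γ. The equation satisfied by γ, divided by γ, makes γ^(p-1)/p a
fixed point of a contraction preserving ℤ_p, hence a unit of ℤ_p. So g^(n(p-1)) is p times a unit,
and O is a closed subring of the unit ball in which g divides every element of norm less than 1
(`isUnif_of_pow_eq_gamma`). Consequently C₀ is complete, separated and torsion-free with respect to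
g, and the problem can be attacked modulo g.

The weight is subadditive, and additive exactly on pairs of exponents in a common cone of the fan
with rays (1,0), (0,1), (-1,-1). Hence the monomials normalised by g^(nω) multiply modulo g as in
k[x,y,z]/(xyz), with k = O/(g) and z = 1/(xy), graded by the weights 1, n, n. The bound |γ_i p^i| ≤
|γ|^(p^i+i) leaves only the terms with i = 0, so D_x and D_y reduce to x∂/∂x + (n x^n - tz) and
y∂/∂y + (y - tz). The derivations preserve the weight; the symbols n x^n - tz and y - tz raise it by
n.

Killing both symbols turns k[x,y,z] into k[x] and xyz into a unit times x^(2n+1). This yields 2n+1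
basis monomials and shows that the only syzygies of the symbols modulo xyz are the Koszul ones
(`symb_exact`). Inductions on the weight give generation and Koszul exactness for the reduced
operators (`redSpan_eq_top`, `redD_exact`).

Generation lifts to C₀ by successive approximation (`surjective_of_surjective_mod`). Independence
lifts by descent (`coeff_eq_zero_of_exact_mod`): in a relation ∑ c_i ε̃_i + D_x ξ + D_y η = 0, the
c_i vanish modulo g and (ξ, η) is congruent to some (D_y ζ, -D_x ζ). As D_x and D_y commute, that
pair may be subtracted; one divides by g and repeats, so each c_i is divisible by every power of g.
-/

/-- The logarithmic derivation `x ∂/∂x`, on polynomials in `x`, `y` and `z = 1 / (xy)`. -/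
def logDerX (k : Type*) [CommRing k] :
    Derivation k (MvPolynomial (Fin 3) k) (MvPolynomial (Fin 3) k) :=
  (X 0 : MvPolynomial (Fin 3) k) • pderiv 0 - (X 2 : MvPolynomial (Fin 3) k) • pderiv 2

/-- The logarithmic derivation `y ∂/∂y`, on polynomials in `x`, `y` and `z = 1 / (xy)`. -/
def logDerY (k : Type*) [CommRing k] :
    Derivation k (MvPolynomial (Fin 3) k) (MvPolynomial (Fin 3) k) :=
  (X 1 : MvPolynomial (Fin 3) k) • pderiv 1 - (X 2 : MvPolynomial (Fin 3) k) • pderiv 2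

/-- The leading symbol `n x ^ n - t z` of `D_x`. -/
def symbX (n : ℕ) (t : k) : MvPolynomial (Fin 3) k :=
  monomial (Finsupp.single 0 n) (n : k) - monomial (Finsupp.single 2 1) t

/-- The leading symbol `y - t z` of `D_y`. -/
def symbY (t : k) : MvPolynomial (Fin 3) k :=
  monomial (Finsupp.single 1 1) 1 - monomial (Finsupp.single 2 1) t

/-- The reduction of `D_x`. -/
def redDx (n : ℕ) (t : k) : MvPolynomial (Fin 3) k →ₗ[k] MvPolynomial (Fin 3) k :=
  (logDerX k : MvPolynomial (Fin 3) k →ₗ[k] MvPolynomial (Fin 3) k)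
    + LinearMap.mulLeft k (symbX n t)

/-- The reduction of `D_y`. -/
def redDy (t : k) : MvPolynomial (Fin 3) k →ₗ[k] MvPolynomial (Fin 3) k :=
  (logDerY k : MvPolynomial (Fin 3) k →ₗ[k] MvPolynomial (Fin 3) k)
    + LinearMap.mulLeft k (symbY t)

/-- The product `xyz`. -/
def xyz (k : Type*) [CommRing k] : MvPolynomial (Fin 3) k := X 0 * X 1 * X 2

/-- The exponent of `x ^ A y ^ j z ^ l`. -/
def expo (A j l : ℕ) : Fin 3 →₀ ℕ :=
  Finsupp.single 0 A + Finsupp.single 1 j + Finsupp.single 2 l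

/-- The exponent of the `i`-th basis monomial. -/
def basisExpo (n i : ℕ) : Fin 3 →₀ ℕ := if i ≤ n then expo i 0 0 else expo (i - n) 1 0

theorem redDx_apply (n : ℕ) (t : k) (q : MvPolynomial (Fin 3) k) :
    redDx n t q = logDerX k q + symbX n t * q := rfl

theorem redDy_apply (t : k) (q : MvPolynomial (Fin 3) k) :
    redDy t q = logDerY k q + symbY t * q := rfl

theorem logDerX_apply (q : MvPolynomial (Fin 3) k) :
    logDerX k q = X 0 * pderiv 0 q - X 2 * pderiv 2 q := rfl

theorem logDerY_apply (q : MvPolynomial (Fin 3) k) :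
    logDerY k q = X 1 * pderiv 1 q - X 2 * pderiv 2 q := rfl

@[simp] theorem expo_zero (A j l : ℕ) : expo A j l 0 = A := by simp [expo]
@[simp] theorem expo_one (A j l : ℕ) : expo A j l 1 = j := by simp [expo]
@[simp] theorem expo_two (A j l : ℕ) : expo A j l 2 = l := by simp [expo]

theorem finsupp_fin_three_ext {d e : Fin 3 →₀ ℕ} (h0 : d 0 = e 0) (h1 : d 1 = e 1)
    (h2 : d 2 = e 2) : d = e := by
  ext i
  fin_cases i <;> assumption

theorem eq_expo (d : Fin 3 →₀ ℕ) : d = expo (d 0) (d 1) (d 2) :=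
  finsupp_fin_three_ext (by simp) (by simp) (by simp)

theorem logDerX_monomial (d : Fin 3 →₀ ℕ) (r : k) :
    logDerX k (monomial d r) = monomial d (((d 0 : k) - d 2) * r) := by
  rw [logDerX_apply, X_mul_pderiv_monomial, X_mul_pderiv_monomial, ← map_nsmul, ← map_nsmul,
    ← map_sub]
  congr 1
  simp only [nsmul_eq_mul]; ring

theorem logDerY_monomial (d : Fin 3 →₀ ℕ) (r : k) :
    logDerY k (monomial d r) = monomial d (((d 1 : k) - d 2) * r) := by
  rw [logDerY_apply, X_mul_pderiv_monomial, X_mul_pderiv_monomial, ← map_nsmul, ← map_nsmul,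
    ← map_sub]
  congr 1
  simp only [nsmul_eq_mul]; ring

theorem coeff_logDerX (d : Fin 3 →₀ ℕ) (q : MvPolynomial (Fin 3) k) :
    coeff d (logDerX k q) = ((d 0 : k) - d 2) * coeff d q := by
  classical
  induction q using MvPolynomial.induction_on' with
  | monomial e r =>
    rw [logDerX_monomial, coeff_monomial, coeff_monomial]
    split_ifs with h
    · rw [h]
    · simp
  | add q r hq hr => rw [map_add, coeff_add, coeff_add, hq, hr]; ring

theorem coeff_logDerY (d : Fin 3 →₀ ℕ) (q : MvPolynomial (Fin 3) k) :
    coeff d (logDerY k q) = ((d 1 : k) - d 2) * coeff d q := by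
  classical
  induction q using MvPolynomial.induction_on' with
  | monomial e r =>
    rw [logDerY_monomial, coeff_monomial, coeff_monomial]
    split_ifs with h
    · rw [h]
    · simp
  | add q r hq hr => rw [map_add, coeff_add, coeff_add, hq, hr]; ring

/-- Each derivation sends the other operator's symbol to tz, so the two cross terms in the
commutator cancel. -/
theorem redDx_comm_redDy (n : ℕ) (t : k) (q : MvPolynomial (Fin 3) k) :
    redDx n t (redDy t q) = redDy t (redDx n t q) := by
  have h : logDerX k (logDerY k q) = logDerY k (logDerX k q) := by
    ext d
    simp only [coeff_logDerX, coeff_logDerY]; ring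
  have hx : logDerX k (symbY t) = monomial (Finsupp.single 2 1) t := by
    rw [symbY, map_sub, logDerX_monomial, logDerX_monomial]; simp
  have hy : logDerY k (symbX n t) = monomial (Finsupp.single 2 1) t := by
    rw [symbX, map_sub, logDerY_monomial, logDerY_monomial]; simp
  simp only [redDx_apply, redDy_apply, map_add, Derivation.leibniz, smul_eq_mul, h, hx, hy]
  ring

theorem xyz_eq : xyz k = monomial (expo 1 1 1) 1 := by
  simp only [xyz, expo, X, monomial_mul, mul_one]

/-- The ideal (xyz) is monomial, so a class modulo it is the list of coefficients at monomials
missing a variable. These monomials are indexed by ℤ² through `expOf`. -/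
theorem xyz_dvd_iff (q : MvPolynomial (Fin 3) k) :
    xyz k ∣ q ↔ ∀ d : Fin 3 →₀ ℕ, (d 0 = 0 ∨ d 1 = 0 ∨ d 2 = 0) → coeff d q = 0 := by
  have hle : ∀ d : Fin 3 →₀ ℕ, (d 0 = 0 ∨ d 1 = 0 ∨ d 2 = 0) ↔ ¬ expo 1 1 1 ≤ d := by
    intro d
    rw [Finsupp.le_def, Fin.forall_fin_succ, Fin.forall_fin_two]
    simp only [Fin.succ_zero_eq_one, Fin.succ_one_eq_two, expo_zero, expo_one, expo_two]
    omega
  rw [xyz_eq, monomial_one_dvd_iff_modMonomial_eq_zero]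
  constructor
  · intro h d hd
    rw [← coeff_modMonomial_of_not_le q ((hle d).1 hd), h, coeff_zero]
  · intro h
    ext d
    by_cases hd : expo 1 1 1 ≤ d
    · rw [coeff_modMonomial_of_le q hd, coeff_zero]
    · rw [coeff_modMonomial_of_not_le q hd, h d ((hle d).2 hd), coeff_zero]

theorem xyz_dvd_redDx (n : ℕ) (t : k) {q : MvPolynomial (Fin 3) k} (h : xyz k ∣ q) :
    xyz k ∣ redDx n t q := by
  refine dvd_add ?_ (h.mul_left _)
  rw [xyz_dvd_iff] at h ⊢
  intro d hd
  rw [Derivation.coeFn_coe, coeff_logDerX, h d hd, mul_zero]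

theorem xyz_dvd_redDy (t : k) {q : MvPolynomial (Fin 3) k} (h : xyz k ∣ q) :
    xyz k ∣ redDy t q := by
  refine dvd_add ?_ (h.mul_left _)
  rw [xyz_dvd_iff] at h ⊢
  intro d hd
  rw [Derivation.coeFn_coe, coeff_logDerY, h d hd, mul_zero]

/-! #### Spanning -/

theorem symbX_mul_monomial (n : ℕ) (t : k) (A j l : ℕ) :
    symbX n t * monomial (expo A j l) 1
      = (n : k) • monomial (expo (A + n) j l) 1 - t • monomial (expo A j (l + 1)) 1 := by
  have h1 : Finsupp.single 0 n + expo A j l = expo (A + n) j l := by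
    refine finsupp_fin_three_ext ?_ ?_ ?_ <;> simp [add_comm]
  have h2 : Finsupp.single 2 1 + expo A j l = expo A j (l + 1) := by
    refine finsupp_fin_three_ext ?_ ?_ ?_ <;> simp [add_comm]
  rw [symbX, sub_mul, monomial_mul, monomial_mul, smul_monomial, smul_monomial, h1, h2]
  rfl

theorem symbY_mul_monomial (t : k) (A j l : ℕ) :
    symbY t * monomial (expo A j l) 1
      = (1 : k) • monomial (expo A (j + 1) l) 1 - t • monomial (expo A j (l + 1)) 1 := by
  have h1 : Finsupp.single 1 1 + expo A j l = expo A (j + 1) l := by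
    refine finsupp_fin_three_ext ?_ ?_ ?_ <;> simp [add_comm]
  have h2 : Finsupp.single 2 1 + expo A j l = expo A j (l + 1) := by
    refine finsupp_fin_three_ext ?_ ?_ ?_ <;> simp [add_comm]
  rw [symbY, sub_mul, monomial_mul, monomial_mul, smul_monomial, smul_monomial, h1, h2]
  rfl

theorem mem_iff_of_smul_sub_smul_mem {M : Type*} [AddCommGroup M] [Module k M]
    {S : Submodule k M} {r s : k} (hr : IsUnit r) (hs : IsUnit s) {u v : M}
    (h : r • u - s • v ∈ S) : u ∈ S ↔ v ∈ S := by
  refine (Submodule.smul_mem_iff_of_isUnit S hr).symm.trans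
    (Iff.trans ⟨fun hu => ?_, fun hv => ?_⟩ (Submodule.smul_mem_iff_of_isUnit S hs))
  · simpa only [sub_sub_cancel] using S.sub_mem hu h
  · simpa only [sub_add_cancel] using S.add_mem h hv

/-- The span of the basis monomials, the images of the reduced operators, and `xyz`. -/
def redSpan (n : ℕ) (t : k) : Submodule k (MvPolynomial (Fin 3) k) :=
  Submodule.span k (Set.range fun i : Fin (2 * n + 1) => monomial (basisExpo n i) (1 : k))
    ⊔ LinearMap.range (redDx n t) ⊔ LinearMap.range (redDy t)
    ⊔ (Ideal.span {xyz k}).restrictScalars k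

/-- Up to lower weight the operators give n x^n ≡ tz and y ≡ tz with n and t units, so factors y and
z can be traded for x^n. The outer induction is on the weight w, the inner one on the degree N in y
and z. -/
theorem monomial_mem_redSpan {n : ℕ} (hn : 0 < n) {t : k} (hnk : IsUnit (n : k)) (ht : IsUnit t)
    (w : ℕ) : ∀ N A j l : ℕ, A + n * (j + l) = w → j + l = N →
      monomial (expo A j l) (1 : k) ∈ redSpan n t := by
  induction w using Nat.strong_induction_on with
  | _ w ihw =>
  have hlow : ∀ A j l : ℕ, A + n * (j + l) < w →
      monomial (expo A j l) (1 : k) ∈ redSpan n t := fun A j l h => ihw _ h _ A j l rfl rfl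
  have hX : ∀ q, redDx n t q ∈ redSpan n t := fun q =>
    Submodule.mem_sup_left (Submodule.mem_sup_left (Submodule.mem_sup_right ⟨q, rfl⟩))
  have hY : ∀ q, redDy t q ∈ redSpan n t := fun q =>
    Submodule.mem_sup_left (Submodule.mem_sup_right ⟨q, rfl⟩)
  have hV : ∀ i < 2 * n + 1, monomial (basisExpo n i) (1 : k) ∈ redSpan n t := fun i hi =>
    Submodule.mem_sup_left (Submodule.mem_sup_left (Submodule.mem_sup_left
      (Submodule.subset_span ⟨⟨i, hi⟩, rfl⟩)))
  have hI : ∀ A j l, monomial (expo (A + 1) (j + 1) (l + 1)) (1 : k) ∈ redSpan n t := by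
    refine fun A j l => Submodule.mem_sup_right ?_
    rw [Submodule.restrictScalars_mem, Ideal.mem_span_singleton, xyz_dvd_iff]
    intro d hd
    classical
    rw [coeff_monomial, if_neg]
    rintro rfl
    simp at hd
  have relX : ∀ A j l : ℕ, A + n * (j + l) < w →
      (monomial (expo (A + n) j l) (1 : k) ∈ redSpan n t ↔
        monomial (expo A j (l + 1)) (1 : k) ∈ redSpan n t) := by
    intro A j l h
    have h1 := hX (monomial (expo A j l) 1)
    rw [redDx_apply, logDerX_monomial, symbX_mul_monomial, ← smul_eq_mul, ← smul_monomial] at h1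
    exact mem_iff_of_smul_sub_smul_mem hnk ht
      ((Submodule.add_mem_iff_right _ (Submodule.smul_mem _ _ (hlow A j l h))).1 h1)
  have relY : ∀ A j l : ℕ, A + n * (j + l) < w →
      (monomial (expo A (j + 1) l) (1 : k) ∈ redSpan n t ↔
        monomial (expo A j (l + 1)) (1 : k) ∈ redSpan n t) := by
    intro A j l h
    have h1 := hY (monomial (expo A j l) 1)
    rw [redDy_apply, logDerY_monomial, symbY_mul_monomial, ← smul_eq_mul, ← smul_monomial] at h1
    exact mem_iff_of_smul_sub_smul_mem isUnit_one ht
      ((Submodule.add_mem_iff_right _ (Submodule.smul_mem _ _ (hlow A j l h))).1 h1)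
  intro N
  induction N with
  | zero =>
    intro A j l hw hN
    obtain ⟨rfl, rfl⟩ : j = 0 ∧ l = 0 := by omega
    obtain rfl : A = w := by simpa using hw
    rcases le_or_gt A n with h1 | h1
    · have := hV A (by omega)
      rwa [basisExpo, if_pos h1] at this
    obtain ⟨B, rfl⟩ := Nat.exists_eq_add_of_le' h1.le
    -- Trade x^(B+n) for x^B z, then for x^B y. This is a basis monomial if B ≤ n; otherwise one
    -- more trade produces the multiple x^(D+1) y z of xyz.
    rw [relX B 0 0 (by omega), ← relY B 0 0 (by omega)]
    rcases le_or_gt B n with h2 | h2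
    · have := hV (B + n) (by omega)
      rwa [basisExpo, if_neg (by omega), Nat.add_sub_cancel] at this
    obtain ⟨D, rfl⟩ := Nat.exists_eq_add_of_lt h2
    have h3 := hI D 0 0
    rw [show n + D + 1 = (D + 1) + n by ring, relX (D + 1) 1 0 (by lia)]
    exact h3
  | succ N ih =>
    intro A j l hw hN
    -- A factor z is traded for x^n, which lowers N and keeps the weight; a factor y is first turned
    -- into z.
    have key : ∀ j l : ℕ, j + l = N → A + n * (j + l + 1) = w →
        monomial (expo A j (l + 1)) (1 : k) ∈ redSpan n t := by
      intro j l hjl hwt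
      rw [← relX A j l (by lia)]
      exact ih _ j l (by lia) hjl
    rcases j with _ | j
    · rcases l with _ | l
      · omega
      · exact key 0 l (by omega) (by rw [← hw]; ring)
    · rw [relY A j l (by lia)]
      exact key j l (by omega) (by rw [← hw]; ring)

theorem redSpan_eq_top {n : ℕ} (hn : 0 < n) {t : k} (hnk : IsUnit (n : k)) (ht : IsUnit t) :
    redSpan n t = ⊤ := by
  refine eq_top_iff.2 fun q _ => ?_
  rw [q.as_sum]
  refine Submodule.sum_mem _ fun d _ => ?_
  rw [← mul_one (coeff d q), ← smul_eq_mul, ← smul_monomial, eq_expo d]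
  exact Submodule.smul_mem _ _ (monomial_mem_redSpan hn hnk ht _ _ _ _ _ rfl rfl)

/-! #### Exactness for the symbols -/

/-- The linear combination of the basis monomials with coefficients `v`. -/
def basisComb (n : ℕ) (v : Fin (2 * n + 1) → k) : MvPolynomial (Fin 3) k :=
  ∑ i : Fin (2 * n + 1), monomial (basisExpo n i) (v i)

theorem exists_eq_redDx_add_redDy {n : ℕ} (hn : 0 < n) {t : k} (hnk : IsUnit (n : k))
    (ht : IsUnit t) (q : MvPolynomial (Fin 3) k) :
    ∃ v ξ η, xyz k ∣ q - (basisComb n v + redDx n t ξ + redDy t η) := by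
  have hq : q ∈ redSpan n t := by rw [redSpan_eq_top hn hnk ht]; trivial
  obtain ⟨q', hq', i, hi, rfl⟩ := Submodule.mem_sup.1 hq
  obtain ⟨q'', hq'', _, ⟨η, rfl⟩, rfl⟩ := Submodule.mem_sup.1 hq'
  obtain ⟨b, hb, _, ⟨ξ, rfl⟩, rfl⟩ := Submodule.mem_sup.1 hq''
  obtain ⟨v, rfl⟩ := (Submodule.mem_span_range_iff_exists_fun k).1 hb
  refine ⟨v, ξ, η, ?_⟩
  have : basisComb n v = ∑ i : Fin (2 * n + 1), v i • monomial (basisExpo n i) (1 : k) := by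
    simp [basisComb, smul_monomial]
  rw [this, add_sub_cancel_left]
  exact Ideal.mem_span_singleton.1 hi

/-- The substitution `y = n x ^ n`, `z = (n / t) x ^ n` (with `s = 1 / t`), which kills both
symbols. -/
def substX (n : ℕ) (s : k) : MvPolynomial (Fin 3) k →ₐ[k] Polynomial k :=
  aeval ![Polynomial.X, Polynomial.C (n : k) * Polynomial.X ^ n,
    Polynomial.C ((n : k) * s) * Polynomial.X ^ n]

/-- The substitution `y = t z`, which kills the symbol of `D_y`. -/
def substY (t : k) : MvPolynomial (Fin 3) k →ₐ[k] MvPolynomial (Fin 3) k :=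
  aeval ![X 0, C t * X 2, X 2]

theorem symbX_eq (n : ℕ) (t : k) : symbX n t = C (n : k) * X 0 ^ n - C t * X 2 := by
  rw [symbX, ← C_mul_X_pow_eq_monomial, ← C_mul_X_pow_eq_monomial, pow_one]

theorem symbY_eq (t : k) : symbY t = X 1 - C t * X 2 := by
  rw [symbY, ← C_mul_X_pow_eq_monomial, ← C_mul_X_pow_eq_monomial, pow_one, pow_one, C_1, one_mul]

theorem substX_symbX (n : ℕ) {t s : k} (hs : t * s = 1) : substX n s (symbX n t) = 0 := by
  have : Polynomial.C t * Polynomial.C s = 1 := by rw [← Polynomial.C_mul, hs, Polynomial.C_1]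
  simp [substX, symbX_eq]
  linear_combination (- (n : Polynomial k) * Polynomial.X ^ n) * this

theorem substX_symbY (n : ℕ) {t s : k} (hs : t * s = 1) : substX n s (symbY t) = 0 := by
  have : Polynomial.C t * Polynomial.C s = 1 := by rw [← Polynomial.C_mul, hs, Polynomial.C_1]
  simp [substX, symbY_eq]
  linear_combination (- (n : Polynomial k) * Polynomial.X ^ n) * this

/-- Modulo the two symbols y and z are multiples of x^n, so the quotient map factors through
`substX`. -/
theorem exists_eq_symb_of_substX_eq_zero (n : ℕ) {t s : k} (hs : t * s = 1)
    {q : MvPolynomial (Fin 3) k} (hq : substX n s q = 0) :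
    ∃ α β, q = symbX n t * α + symbY t * β := by
  set J : Ideal (MvPolynomial (Fin 3) k) := Ideal.span {symbX n t, symbY t} with hJ
  have hX : symbX n t ∈ J := Ideal.subset_span (by simp)
  have hY : symbY t ∈ J := Ideal.subset_span (by simp)
  have hC : (C t * C s : MvPolynomial (Fin 3) k) = 1 := by rw [← C_mul, hs, C_1]
  have h : Ideal.Quotient.mkₐ k J
      = ((Ideal.Quotient.mkₐ k J).comp (Polynomial.aeval (X 0))).comp (substX n s) := by
    refine MvPolynomial.algHom_ext fun i => ?_
    fin_cases i
    · simp [substX]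
    · simp only [substX, AlgHom.comp_apply, aeval_X]
      refine (Ideal.Quotient.mk_eq_mk_iff_sub_mem _ _).2 ?_
      convert J.sub_mem hY hX using 1
      simp [symbX_eq, symbY_eq]
    · simp only [substX, AlgHom.comp_apply, aeval_X]
      refine (Ideal.Quotient.mk_eq_mk_iff_sub_mem _ _).2 ?_
      convert J.mul_mem_left (- C s) hX using 1
      simp [symbX_eq, MvPolynomial.algebraMap_eq]
      linear_combination (- X 2) * hC
  have h2 : Ideal.Quotient.mkₐ k J q = 0 := by
    rw [h, AlgHom.comp_apply, hq, map_zero]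
  obtain ⟨α, β, h3⟩ := Ideal.mem_span_pair.1 (Ideal.Quotient.eq_zero_iff_mem.1 h2)
  exact ⟨α, β, by rw [← h3]; ring⟩

theorem exists_eq_symbY_mul_of_substY_eq_zero {t : k}
    {q : MvPolynomial (Fin 3) k} (hq : substY t q = 0) : ∃ ζ, q = symbY t * ζ := by
  set J : Ideal (MvPolynomial (Fin 3) k) := Ideal.span {symbY t} with hJ
  have hY : symbY t ∈ J := Ideal.subset_span (by simp)
  have h : Ideal.Quotient.mkₐ k J = (Ideal.Quotient.mkₐ k J).comp (substY t) := by
    refine MvPolynomial.algHom_ext fun i => ?_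
    fin_cases i
    · simp [substY]
    · simp only [substY, AlgHom.comp_apply, aeval_X]
      refine (Ideal.Quotient.mk_eq_mk_iff_sub_mem _ _).2 ?_
      convert hY using 1
      simp [symbY_eq]
    · simp [substY]
  have h2 : Ideal.Quotient.mkₐ k J q = 0 := by
    rw [h, AlgHom.comp_apply, hq, map_zero]
  exact Ideal.mem_span_singleton.1 (Ideal.Quotient.eq_zero_iff_mem.1 h2)

theorem symbX_ne_zero [Nontrivial k] (n : ℕ) {t : k} (ht : IsUnit t) : symbX n t ≠ 0 := by
  intro h
  have := congrArg (coeff (Finsupp.single 2 1)) h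
  classical
  rw [symbX, coeff_sub, coeff_monomial, coeff_monomial, if_neg, if_pos rfl, coeff_zero] at this
  · exact ht.ne_zero (by simpa using this)
  · intro h
    simpa using DFunLike.congr_fun h 2

theorem symbY_ne_zero [Nontrivial k] {t : k} (ht : IsUnit t) : symbY t ≠ 0 := by
  intro h
  have := congrArg (coeff (Finsupp.single 2 1)) h
  classical
  rw [symbY, coeff_sub, coeff_monomial, coeff_monomial, if_neg, if_pos rfl, coeff_zero] at this
  · exact ht.ne_zero (by simpa using this)
  · intro h
    simpa using DFunLike.congr_fun h 2

theorem substX_basisComb (n : ℕ) (s : k) (v : Fin (2 * n + 1) → k) :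
    substX n s (basisComb n v)
      = ∑ i : Fin (2 * n + 1),
        Polynomial.monomial (i : ℕ) (v i * if (i : ℕ) ≤ n then 1 else n) := by
  rw [basisComb, map_sum]
  refine Finset.sum_congr rfl fun i _ => ?_
  rw [basisExpo, ← Polynomial.C_mul_X_pow_eq_monomial]
  split_ifs with h
  · simp [substX, expo, aeval_monomial]
  · rw [substX, expo, aeval_monomial]
    obtain ⟨j, hj⟩ := Nat.exists_eq_add_of_le' (not_le.1 h).le
    simp [Finsupp.prod_add_index', pow_add, hj]
    ring

/-- Under `substX` the symbols vanish and xyz becomes (n²/t) x^(2n+1), while the basis combination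
has degree at most 2n. Hence both sides vanish: v = 0, and the cofactor q of xyz is a combination of
the symbols. Absorbing it leaves a syzygy between the two symbols. -/
theorem symb_exact [IsDomain k] {n : ℕ} {t : k} (hnk : IsUnit (n : k)) (ht : IsUnit t)
    {v : Fin (2 * n + 1) → k} {ξ η : MvPolynomial (Fin 3) k}
    (h : xyz k ∣ basisComb n v + symbX n t * ξ + symbY t * η) :
    v = 0 ∧ ∃ ζ, xyz k ∣ ξ - symbY t * ζ ∧ xyz k ∣ η + symbX n t * ζ := by
  obtain ⟨s, hs⟩ := ht.exists_right_inv
  obtain ⟨q, hq⟩ := h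
  have hsubst : substX n s (basisComb n v)
      = Polynomial.C ((n : k) * n * s) * substX n s q * Polynomial.X ^ (2 * n + 1) := by
    have := congrArg (substX n s) hq
    rw [map_add, map_add, map_mul, map_mul, map_mul, substX_symbX n hs, substX_symbY n hs, zero_mul,
      zero_mul, add_zero, add_zero] at this
    rw [this, xyz]
    simp [substX]
    ring
  have hv : v = 0 := by
    funext i
    have h1 := congrArg (fun f => Polynomial.coeff f (i : ℕ)) hsubst
    rw [substX_basisComb] at h1
    simp only [Polynomial.finsetSum_coeff, Polynomial.coeff_monomial,
      Polynomial.coeff_mul_X_pow', if_neg (not_le.2 i.2), Fin.val_inj, Finset.sum_ite_eq',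
      Finset.mem_univ, if_true] at h1
    split_ifs at h1
    · simpa using h1
    · exact (mul_eq_zero.1 h1).resolve_right hnk.ne_zero
  have hb : basisComb n v = 0 := by simp [basisComb, hv]
  have hq0 : substX n s q = 0 := by
    rw [hb, map_zero, eq_comm] at hsubst
    have h1 := (mul_eq_zero.1 hsubst).resolve_right (pow_ne_zero _ Polynomial.X_ne_zero)
    refine (mul_eq_zero.1 h1).resolve_left ?_
    refine Polynomial.C_ne_zero.2 (mul_ne_zero (mul_ne_zero hnk.ne_zero hnk.ne_zero) ?_)
    rintro rfl
    simp at hs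
  obtain ⟨α, β, rfl⟩ := exists_eq_symb_of_substX_eq_zero n hs hq0
  rw [hb, zero_add] at hq
  have h0 : symbX n t * (ξ - xyz k * α) + symbY t * (η - xyz k * β) = 0 := by
    linear_combination hq
  -- Setting y = tz kills the symbol of D_y and fixes the nonzero symbol of D_x, so in a domain the
  -- cofactor of the latter is killed too: the syzygy is Koszul.
  have hψX : substY t (symbX n t) = symbX n t := by simp [substY, symbX_eq]
  have hψY : substY t (symbY t) = 0 := by simp [substY, symbY_eq]
  have h1 : substY t (ξ - xyz k * α) = 0 := by
    have := congrArg (substY t) h0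
    rw [map_add, map_mul, map_mul, hψX, hψY, zero_mul, add_zero, map_zero] at this
    exact (mul_eq_zero.1 this).resolve_left (symbX_ne_zero n ht)
  obtain ⟨ζ, hζ⟩ := exists_eq_symbY_mul_of_substY_eq_zero h1
  refine ⟨hv, ζ, ⟨α, by rw [← hζ]; ring⟩, ⟨β, ?_⟩⟩
  rw [hζ] at h0
  have h2 : symbY t * (symbX n t * ζ + (η - xyz k * β)) = 0 := by linear_combination h0
  linear_combination (mul_eq_zero.1 h2).resolve_left (symbY_ne_zero ht)

/-! #### Exactness for the reduced operators -/

/-- The weights of `x`, `y`, `z`. -/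
abbrev varWt (n : ℕ) : Fin 3 → ℕ := ![1, n, n]

theorem weight_varWt (n : ℕ) (d : Fin 3 →₀ ℕ) :
    Finsupp.weight (varWt n) d = d 0 + n * (d 1 + d 2) := by
  rw [Finsupp.weight_apply, Finsupp.sum_fintype _ _ (by simp), Fin.sum_univ_three]
  simp
  ring

theorem weightedHomogeneousComponent_monomial_mul {n w e : ℕ} {s : Fin 3 →₀ ℕ}
    (hs : Finsupp.weight (varWt n) s = e) (r : k) (q : MvPolynomial (Fin 3) k) :
    weightedHomogeneousComponent (varWt n) (w + e) (monomial s r * q)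
      = monomial s r * weightedHomogeneousComponent (varWt n) w q := by
  ext d
  rw [coeff_weightedHomogeneousComponent, coeff_monomial_mul', coeff_monomial_mul',
    coeff_weightedHomogeneousComponent]
  by_cases h : s ≤ d
  · have : Finsupp.weight (varWt n) d = Finsupp.weight (varWt n) (d - s) + e := by
      rw [← hs, ← map_add, tsub_add_cancel_of_le h]
    simp [h, this]
  · simp [h]

theorem weightedHomogeneousComponent_symbX_mul (n w : ℕ) (t : k) (q : MvPolynomial (Fin 3) k) :
    weightedHomogeneousComponent (varWt n) (w + n) (symbX n t * q)
      = symbX n t * weightedHomogeneousComponent (varWt n) w q := by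
  rw [symbX, sub_mul, sub_mul, map_sub, weightedHomogeneousComponent_monomial_mul,
    weightedHomogeneousComponent_monomial_mul] <;> simp [weight_varWt]

theorem weightedHomogeneousComponent_symbY_mul (n w : ℕ) (t : k) (q : MvPolynomial (Fin 3) k) :
    weightedHomogeneousComponent (varWt n) (w + n) (symbY t * q)
      = symbY t * weightedHomogeneousComponent (varWt n) w q := by
  rw [symbY, sub_mul, sub_mul, map_sub, weightedHomogeneousComponent_monomial_mul,
    weightedHomogeneousComponent_monomial_mul] <;> simp [weight_varWt]

theorem weight_basisExpo (n i : ℕ) : Finsupp.weight (varWt n) (basisExpo n i) = i := by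
  rw [weight_varWt, basisExpo]
  split_ifs with h
  · simp
  · simp; omega

theorem weightedHomogeneousComponent_basisComb (n w : ℕ) (v : Fin (2 * n + 1) → k) :
    weightedHomogeneousComponent (varWt n) w (basisComb n v)
      = basisComb n (fun i => if (i : ℕ) = w then v i else 0) := by
  classical
  rw [basisComb, basisComb, map_sum]
  refine Finset.sum_congr rfl fun i _ => ?_
  ext d
  rw [coeff_weightedHomogeneousComponent, coeff_monomial, coeff_monomial]
  by_cases h : basisExpo n i = d
  · rw [← h, weight_basisExpo]; simp
  · simp [h]

theorem xyz_dvd_weightedHomogeneousComponent (n w : ℕ) {q : MvPolynomial (Fin 3) k}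
    (h : xyz k ∣ q) : xyz k ∣ weightedHomogeneousComponent (varWt n) w q := by
  rw [xyz_dvd_iff] at h ⊢
  intro d hd
  rw [coeff_weightedHomogeneousComponent, h d hd, ite_self]

/-- The component of ζ of weight w - n serves for both symbols; if w < n it is zero. Its weights lie
strictly below w, so the derivatives of ζ' do not spoil the descent in `redD_exact_of_weight_lt`. -/
theorem exists_weightedHomogeneousComponent_symb_mul {n : ℕ} (hn : 0 < n) (w : ℕ) (t : k)
    (ζ : MvPolynomial (Fin 3) k) :
    ∃ ζ', weightedHomogeneousComponent (varWt n) w (symbX n t * ζ) = symbX n t * ζ' ∧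
      weightedHomogeneousComponent (varWt n) w (symbY t * ζ) = symbY t * ζ' ∧
      ∀ d, w ≤ Finsupp.weight (varWt n) d → coeff d ζ' = 0 := by
  rcases le_or_gt n w with h | h
  · obtain ⟨w, rfl⟩ := Nat.exists_eq_add_of_le' h
    refine ⟨_, weightedHomogeneousComponent_symbX_mul n w t ζ,
      weightedHomogeneousComponent_symbY_mul n w t ζ, fun d hd => ?_⟩
    rw [coeff_weightedHomogeneousComponent, if_neg (by omega)]
  · have key : ∀ (s : Fin 3 →₀ ℕ) (r : k), Finsupp.weight (varWt n) s = n →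
        weightedHomogeneousComponent (varWt n) w (monomial s r * ζ) = 0 := by
      intro s r hs
      ext d
      rw [coeff_weightedHomogeneousComponent, coeff_monomial_mul', coeff_zero]
      split_ifs with h1 h2
      · have : Finsupp.weight (varWt n) d
            = Finsupp.weight (varWt n) (d - s) + Finsupp.weight (varWt n) s := by
          rw [← map_add, tsub_add_cancel_of_le h2]
        omega
      · rfl
      · rfl
    refine ⟨0, ?_, ?_, by simp⟩
    · rw [symbX, sub_mul, map_sub, key, key] <;> simp [weight_varWt]
    · rw [symbY, sub_mul, map_sub, key, key] <;> simp [weight_varWt]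

/-- Induction on a strict bound for the weights of ξ and η: their top components satisfy a relation
between symbols, hence form a Koszul syzygy that can be removed. -/
theorem redD_exact_of_weight_lt [IsDomain k] {n : ℕ} (hn : 0 < n) {t : k} (hnk : IsUnit (n : k))
    (ht : IsUnit t) {v : Fin (2 * n + 1) → k} (w : ℕ) : ∀ {ξ η : MvPolynomial (Fin 3) k},
    (∀ d, w ≤ Finsupp.weight (varWt n) d → coeff d ξ = 0) →
    (∀ d, w ≤ Finsupp.weight (varWt n) d → coeff d η = 0) →
    xyz k ∣ basisComb n v + redDx n t ξ + redDy t η →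
    v = 0 ∧ ∃ ζ, xyz k ∣ ξ - redDy t ζ ∧ xyz k ∣ η + redDx n t ζ := by
  induction w with
  | zero =>
    intro ξ η hξ hη h
    obtain rfl : ξ = 0 := by ext d; simpa using hξ d
    obtain rfl : η = 0 := by ext d; simpa using hη d
    refine ⟨(symb_exact hnk ht (ξ := 0) (η := 0) (v := v) ?_).1, 0, by simp, by simp⟩
    simpa using h
  | succ w ih =>
    intro ξ η hξ hη h
    have htop : ∀ {q : MvPolynomial (Fin 3) k},
        (∀ d, w + 1 ≤ Finsupp.weight (varWt n) d → coeff d q = 0) →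
        weightedHomogeneousComponent (varWt n) (w + n) (logDerX k q) = 0 ∧
        weightedHomogeneousComponent (varWt n) (w + n) (logDerY k q) = 0 := by
      intro q hq
      constructor <;> ext d <;>
        simp only [coeff_weightedHomogeneousComponent, coeff_logDerX, coeff_logDerY, coeff_zero]
      all_goals
        split_ifs with hd
        · rw [hq d (by omega), mul_zero]
        · rfl
    -- As n > 0 the derivation terms do not reach weight w + n, so this component involves only the
    -- symbols.
    have h1 := xyz_dvd_weightedHomogeneousComponent n (w + n) h
    rw [map_add, map_add, redDx_apply, redDy_apply, map_add, map_add, (htop hξ).1, (htop hη).2,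
      zero_add, zero_add, weightedHomogeneousComponent_symbX_mul,
      weightedHomogeneousComponent_symbY_mul, weightedHomogeneousComponent_basisComb] at h1
    obtain ⟨-, ζ, hζ1, hζ2⟩ := symb_exact hnk ht h1
    obtain ⟨ζ', hX, hY, hζ'⟩ := exists_weightedHomogeneousComponent_symb_mul hn w t ζ
    have hidem : ∀ q : MvPolynomial (Fin 3) k,
        weightedHomogeneousComponent (varWt n) w (weightedHomogeneousComponent (varWt n) w q)
          = weightedHomogeneousComponent (varWt n) w q := by
      intro q
      ext d
      simp only [coeff_weightedHomogeneousComponent]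
      split_ifs <;> rfl
    have hζ3 := xyz_dvd_weightedHomogeneousComponent n w hζ1
    have hζ4 := xyz_dvd_weightedHomogeneousComponent n w hζ2
    rw [map_sub, hidem, hY] at hζ3
    rw [map_add, hidem, hX] at hζ4
    set ξw := weightedHomogeneousComponent (varWt n) w ξ with hξw
    set ηw := weightedHomogeneousComponent (varWt n) w η with hηw
    -- Subtracting (redDy ζ', -redDx ζ') leaves, modulo xyz, a pair with weights below w. The
    -- relation survives because the operators commute.
    have hξ' : xyz k ∣ ξ - redDy t ζ' - (ξ - ξw - logDerY k ζ') := by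
      convert hζ3 using 1
      rw [redDy_apply]; ring
    have hη' : xyz k ∣ η + redDx n t ζ' - (η - ηw + logDerX k ζ') := by
      convert hζ4 using 1
      rw [redDx_apply]; ring
    have hlow : ∀ {q : MvPolynomial (Fin 3) k},
        (∀ d, w + 1 ≤ Finsupp.weight (varWt n) d → coeff d q = 0) →
        ∀ d, w ≤ Finsupp.weight (varWt n) d →
          coeff d (q - weightedHomogeneousComponent (varWt n) w q) = 0 := by
      intro q hq d hd
      rw [coeff_sub, coeff_weightedHomogeneousComponent]
      split_ifs with h2
      · rw [sub_self]
      · rw [hq d (by omega), sub_zero]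
    obtain ⟨hv, ζ'', h2, h3⟩ := ih (ξ := ξ - ξw - logDerY k ζ') (η := η - ηw + logDerX k ζ')
      (fun d hd => by rw [coeff_sub, hlow hξ d hd, coeff_logDerY, hζ' d hd]; simp)
      (fun d hd => by rw [coeff_add, hlow hη d hd, coeff_logDerX, hζ' d hd]; simp)
      (by
        have h4 := dvd_sub (dvd_sub h (xyz_dvd_redDx n t hξ')) (xyz_dvd_redDy t hη')
        convert h4 using 1
        simp only [map_sub, map_add, redDx_comm_redDy]
        ring)
    refine ⟨hv, ζ' + ζ'', ?_, ?_⟩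
    · convert dvd_add hξ' h2 using 1
      rw [map_add]; ring
    · convert dvd_add hη' h3 using 1
      rw [map_add]; ring

theorem redD_exact [IsDomain k] {n : ℕ} (hn : 0 < n) {t : k} (hnk : IsUnit (n : k))
    (ht : IsUnit t) {v : Fin (2 * n + 1) → k} {ξ η : MvPolynomial (Fin 3) k}
    (h : xyz k ∣ basisComb n v + redDx n t ξ + redDy t η) :
    v = 0 ∧ ∃ ζ, xyz k ∣ ξ - redDy t ζ ∧ xyz k ∣ η + redDx n t ζ := by
  have hbound : ∀ q : MvPolynomial (Fin 3) k, ∃ w : ℕ, ∀ d, w ≤ Finsupp.weight (varWt n) d →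
      coeff d q = 0 := by
    intro q
    refine ⟨q.support.sup (Finsupp.weight (varWt n)) + 1, fun d hd => ?_⟩
    by_contra hne
    have := Finset.le_sup (f := Finsupp.weight (varWt n)) (mem_support_iff.2 hne)
    omega
  obtain ⟨w₁, h₁⟩ := hbound ξ
  obtain ⟨w₂, h₂⟩ := hbound η
  exact redD_exact_of_weight_lt hn hnk ht (max w₁ w₂)
    (fun d hd => h₁ d ((le_max_left _ _).trans hd))
    (fun d hd => h₂ d ((le_max_right _ _).trans hd)) h

end Graded

/-! ### The ring `ℤ_q[g]` -/

section RingFacts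

variable (p : ℕ) [Fact p.Prime]

/-- The inclusion of `ℤ_p` into `ℂ_p`. -/
def zpHom : ℤ_[p] →+* ℂ_[p] := (algebraMap ℚ_[p] ℂ_[p]).comp PadicInt.Coe.ringHom

/-- `ℤ_p` as a subring of `ℂ_p`. -/
def ZpC : Subring ℂ_[p] := (zpHom p).range

variable {p}

/-! ### Norms and compactness of ℤ_p inside ℂ_p -/

theorem norm_zpHom (z : ℤ_[p]) : ‖zpHom p z‖ = ‖z‖ := by
  rw [PadicInt.norm_def]
  exact norm_algebraMap' ℂ_[p] (z : ℚ_[p])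

theorem norm_p : ‖(p : ℂ_[p])‖ = (p : ℝ)⁻¹ := by
  rw [← map_natCast (zpHom p), norm_zpHom, PadicInt.norm_p]

theorem p_ne_zero : (p : ℂ_[p]) ≠ 0 := Nat.cast_ne_zero.2 (Fact.out : p.Prime).ne_zero

theorem norm_p_lt_one : ‖(p : ℂ_[p])‖ < 1 := by
  rw [norm_p]
  exact inv_lt_one_of_one_lt₀ (mod_cast (Fact.out : p.Prime).one_lt)

theorem continuous_zpHom : Continuous (zpHom p) :=
  (continuous_algebraMap ℚ_[p] ℂ_[p]).comp continuous_subtype_val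

variable (p) in
theorem isCompact_ZpC : IsCompact (ZpC p : Set ℂ_[p]) := by
  rw [ZpC, RingHom.coe_range]
  exact isCompact_range continuous_zpHom

instance : CompactSpace (ZpC p) := isCompact_iff_compactSpace.1 (isCompact_ZpC p)

theorem norm_le_one_of_mem_ZpC {z : ℂ_[p]} (hz : z ∈ ZpC p) : ‖z‖ ≤ 1 := by
  obtain ⟨z, rfl⟩ := hz
  rw [norm_zpHom]
  exact PadicInt.norm_le_one z

theorem inv_mem_ZpC {z : ℂ_[p]} (hz : z ∈ ZpC p) (h : ‖z‖ = 1) : z⁻¹ ∈ ZpC p := by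
  obtain ⟨z, rfl⟩ := hz
  rw [norm_zpHom] at h
  obtain ⟨w, hw⟩ := (PadicInt.isUnit_iff.2 h).exists_right_inv
  refine ⟨w, eq_inv_of_mul_eq_one_right ?_⟩
  rw [← map_mul, hw, map_one]

/-- Summability is not needed: a non-summable family has sum 0 by convention. -/
theorem tsum_mem_of_isClosed {ι : Type*} {S : Subring ℂ_[p]} (hS : IsClosed (S : Set ℂ_[p]))
    {f : ι → ℂ_[p]} (hf : ∀ i, f i ∈ S) : ∑' i, f i ∈ S := by
  by_cases h : Summable f
  · exact hS.mem_of_tendsto h.hasSum (Eventually.of_forall fun s => S.sum_mem fun i _ => hf i)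
  · rw [tsum_eq_zero_of_not_summable h]
    exact S.zero_mem

theorem norm_tsum_le_of_le {ι : Type*} {f : ι → ℂ_[p]} {C : ℝ} (hC : 0 ≤ C) (hf : ∀ i, ‖f i‖ ≤ C) :
    ‖∑' i, f i‖ ≤ C :=
  (IsUltrametricDist.norm_tsum_le f).trans (Real.iSup_le hf hC)

theorem norm_pow_sub_pow_le {y z : ℂ_[p]} (hy : ‖y‖ ≤ 1) (hz : ‖z‖ ≤ 1) (m : ℕ) :
    ‖y ^ m - z ^ m‖ ≤ ‖y - z‖ := by
  induction m with
  | zero => simp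
  | succ m ih =>
    have : y ^ (m + 1) - z ^ (m + 1) = y ^ m * (y - z) + (y ^ m - z ^ m) * z := by ring
    rw [this]
    refine (IsUltrametricDist.norm_add_le_max _ _).trans (max_le ?_ ?_)
    · rw [norm_mul, norm_pow]
      exact mul_le_of_le_one_left (norm_nonneg _) (pow_le_one₀ (norm_nonneg _) hy)
    · rw [norm_mul]
      exact (mul_le_of_le_one_right (norm_nonneg _) hz).trans ih

/-! #### The number `γ` -/

theorem sub_one_mul_geom_add_one {m : ℕ} (hm : 1 ≤ m) (k : ℕ) :
    (m - 1) * (∑ i ∈ Finset.range k, m ^ i) + 1 = m ^ k := by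
  induction k with
  | zero => simp
  | succ k ih =>
    rw [Finset.sum_range_succ, mul_add, add_right_comm, ih, pow_succ', add_comm, ← Nat.succ_mul]
    congr 1
    omega

/-- Gives the exponent of p in the k-th coefficient of the series in `gamma_pow_div_mem_ZpC` the
lower bound k + 1. -/
theorem geom_ge {m : ℕ} (hm : 2 ≤ m) (k : ℕ) :
    2 * k + 3 ≤ ∑ i ∈ Finset.range (k + 2), m ^ i := by
  induction k with
  | zero => simp [Finset.sum_range_succ]; omega
  | succ k ih =>
    rw [Finset.sum_range_succ]
    have : 2 ≤ m ^ (k + 2) := hm.trans (Nat.le_self_pow (by omega) m)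
    omega

theorem norm_pow_sub_one_of_norm_eq {γ : ℂ_[p]}
    (hγ : ‖γ‖ = (p : ℝ) ^ (-(1 / ((p : ℝ) - 1)))) : ‖γ‖ ^ (p - 1) = (p : ℝ)⁻¹ := by
  have hp : 1 < p := (Fact.out : p.Prime).one_lt
  have hp' : (p : ℝ) - 1 ≠ 0 := sub_ne_zero.2 (by exact_mod_cast hp.ne')
  rw [hγ, ← Real.rpow_natCast, ← Real.rpow_mul (by positivity), Nat.cast_sub hp.le, Nat.cast_one,
    neg_mul, one_div_mul_cancel hp', Real.rpow_neg_one]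

/-- With y = γ^(p-1)/p, the vanishing series divided by γ reads 1 + y + ∑ c_k y^(M(k+2)) = 0, where
|c_k| ≤ p^(-k-1). So y = F(y), where F(z) = -1 - ∑ c_k z^(M(k+2)) maps ℤ_p to itself and contracts
distances in the unit ball by 1/p. -/
theorem gamma_pow_div_mem_ZpC {γ : ℂ_[p]} (hγ : ‖γ‖ ^ (p - 1) = (p : ℝ)⁻¹)
    (hsum : HasSum (fun k : ℕ => γ ^ p ^ k / (p : ℂ_[p]) ^ k) 0) :
    γ ^ (p - 1) / p ∈ ZpC p := by
  have hp : 2 ≤ p := (Fact.out : p.Prime).two_le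
  have hp0 : (0 : ℝ) < p := by positivity
  set y := γ ^ (p - 1) / (p : ℂ_[p]) with hy
  have hy1 : ‖y‖ = 1 := by
    rw [hy, norm_div, norm_pow, hγ, norm_p, div_self (inv_ne_zero hp0.ne')]
  have hγ0 : γ ≠ 0 := by
    rintro rfl
    rw [norm_zero, zero_pow (by omega)] at hγ
    exact (inv_ne_zero hp0.ne') hγ.symm
  have hγy : γ ^ (p - 1) = p * y := by rw [hy, mul_div_cancel₀ _ p_ne_zero]
  set M : ℕ → ℕ := fun k => ∑ i ∈ Finset.range k, p ^ i with hM
  set c : ℕ → ℂ_[p] := fun k => (p : ℂ_[p]) ^ (M (k + 2) - (k + 2)) with hc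
  have hc_mem : ∀ k, c k ∈ ZpC p := fun k =>
    (ZpC p).pow_mem (natCast_mem (ZpC p) p) _
  have hcnorm : ∀ k, ‖c k‖ ≤ (p : ℝ)⁻¹ ^ (k + 1) := by
    intro k
    rw [hc, norm_pow, norm_p]
    refine pow_le_pow_of_le_one (by positivity)
      (inv_le_one_of_one_le₀ (by exact_mod_cast by omega)) ?_
    have := geom_ge hp k
    simp only [hM]
    omega
  -- Since M(k) = (p^k - 1)/(p - 1), one has γ^(p^k) = γ (py)^(M(k)).
  have hterm : ∀ k, γ ^ p ^ (k + 2) / (p : ℂ_[p]) ^ (k + 2) = γ * (c k * y ^ M (k + 2)) := by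
    intro k
    have h1 : p ^ (k + 2) = (p - 1) * M (k + 2) + 1 :=
      (sub_one_mul_geom_add_one (by omega) _).symm
    have h2 : M (k + 2) = (M (k + 2) - (k + 2)) + (k + 2) := by
      have := geom_ge hp k
      simp only [hM]
      omega
    rw [h1, pow_succ, pow_mul, hγy, mul_pow]
    nth_rewrite 1 [h2]
    rw [pow_add, hc]
    have := pow_ne_zero (k + 2) (p_ne_zero (p := p))
    field_simp
  have hsum2 : HasSum (fun k => c k * y ^ M (k + 2)) (-1 - y) := by
    have h1 := (hasSum_nat_add_iff' 2).2 hsum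
    simp only [hterm] at h1
    have h2 := h1.mul_left γ⁻¹
    simp only [inv_mul_cancel_left₀ hγ0] at h2
    suffices h : γ⁻¹ * (0 - ∑ i ∈ Finset.range 2, γ ^ p ^ i / (p : ℂ_[p]) ^ i) = -1 - y by
      rwa [h] at h2
    rw [Finset.sum_range_succ, Finset.sum_range_one]
    have h3 : γ ^ p = γ * γ ^ (p - 1) := by
      rw [← pow_succ', Nat.sub_add_cancel (by omega)]
    rw [pow_zero, pow_one, pow_one, pow_zero, div_one, pow_one, h3, hγy]
    have := p_ne_zero (p := p)
    field_simp
    ring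
  have hsumm : ∀ z : ℂ_[p], ‖z‖ ≤ 1 → Summable fun k => c k * z ^ M (k + 2) := by
    intro z hz
    refine Summable.of_norm_bounded (g := fun k => (p : ℝ)⁻¹ ^ (k + 1)) ?_ fun k => ?_
    · refine (summable_nat_add_iff 1).2 (summable_geometric_of_lt_one (by positivity) ?_)
      exact inv_lt_one_of_one_lt₀ (by exact_mod_cast by omega)
    · rw [norm_mul, norm_pow z]
      exact (mul_le_of_le_one_right (norm_nonneg _) (pow_le_one₀ (norm_nonneg _) hz)).trans
        (hcnorm k)
  -- Take z in the compact set ℤ_p nearest to y. Then F(z) also lies in ℤ_p and is p times closer to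
  -- y, which forces the distance to be 0.
  obtain ⟨z, hz, hdist⟩ := (isCompact_ZpC p).exists_infDist_eq_dist ⟨0, (ZpC p).zero_mem⟩ y
  have hz1 := norm_le_one_of_mem_ZpC hz
  have hFz : -1 - ∑' k, c k * z ^ M (k + 2) ∈ ZpC p :=
    (ZpC p).sub_mem ((ZpC p).neg_mem (ZpC p).one_mem)
      (tsum_mem_of_isClosed (isCompact_ZpC p).isClosed fun k =>
        (ZpC p).mul_mem (hc_mem k) ((ZpC p).pow_mem hz _))
  have h1 : dist y z ≤ dist y (-1 - ∑' k, c k * z ^ M (k + 2)) := by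
    rw [← hdist]
    exact Metric.infDist_le_dist_of_mem hFz
  have h2 : y - (-1 - ∑' k, c k * z ^ M (k + 2))
      = ∑' k, c k * (z ^ M (k + 2) - y ^ M (k + 2)) := by
    have : y = -1 - ∑' k, c k * y ^ M (k + 2) := by rw [hsum2.tsum_eq]; ring
    simp only [mul_sub]
    rw [(hsumm z hz1).tsum_sub (hsumm y hy1.le)]
    nth_rewrite 1 [this]
    ring
  have h3 : dist y (-1 - ∑' k, c k * z ^ M (k + 2)) ≤ (p : ℝ)⁻¹ * dist y z := by
    rw [dist_eq_norm, h2, dist_comm, dist_eq_norm]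
    refine norm_tsum_le_of_le (by positivity) fun k => ?_
    rw [norm_mul]
    refine mul_le_mul ((hcnorm k).trans ?_) (norm_pow_sub_pow_le hz1 hy1.le _) (norm_nonneg _)
      (by positivity)
    exact pow_le_of_le_one (by positivity) (inv_le_one_of_one_le₀ (by exact_mod_cast by omega))
      (by omega)
  have h4 : (p : ℝ)⁻¹ < 1 := inv_lt_one_of_one_lt₀ (by exact_mod_cast by omega)
  have h5 : dist y z = 0 := by
    have := dist_nonneg (x := y) (y := z)
    nlinarith
  rwa [dist_eq_zero.1 h5]

/-- The exponent count for `norm_gammaSeq_mul_le`: as |p| = |γ|^(p-1), a denominator p^(j+1) costs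
(p-1)(j+1) factors of γ. -/
theorem le_prime_pow_aux {m : ℕ} (hm : 2 ≤ m) (i j : ℕ) :
    m ^ i + i + (m - 1) * (j + 1) ≤ m ^ (i + 1 + j) := by
  obtain ⟨l, rfl⟩ := Nat.exists_eq_add_of_le' (show 1 ≤ m by omega)
  rw [Nat.add_sub_cancel]
  induction j with
  | zero =>
    have h1 : i + 1 ≤ (l + 1) ^ i := Nat.lt_pow_self (by omega)
    have h2 : (l + 1) ^ (i + 1 + 0) = l * (l + 1) ^ i + (l + 1) ^ i := by ring
    have h3 : l * (i + 1) ≤ l * (l + 1) ^ i := Nat.mul_le_mul_left _ h1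
    have h4 : i ≤ l * i := Nat.le_mul_of_pos_left _ (by omega)
    rw [h2]
    nlinarith
  | succ j ih =>
    have h1 : 1 ≤ (l + 1) ^ (i + 1 + j) := Nat.one_le_pow _ _ (by omega)
    have h2 : (l + 1) ^ (i + 1 + (j + 1)) = l * (l + 1) ^ (i + 1 + j) + (l + 1) ^ (i + 1 + j) := by
      ring
    have h3 : l * 1 ≤ l * (l + 1) ^ (i + 1 + j) := Nat.mul_le_mul_left _ h1
    rw [h2]
    nlinarith

/-- The full series vanishes, so γ_i is minus its tail from index i + 1 on, and the tail is bounded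
term by term. -/
theorem norm_gammaSeq_mul_le {γ : ℂ_[p]} (hγ : ‖γ‖ ^ (p - 1) = (p : ℝ)⁻¹)
    (hsum : HasSum (fun k : ℕ => γ ^ p ^ k / (p : ℂ_[p]) ^ k) 0) (i : ℕ) :
    ‖gammaSeq p γ i * (p : ℂ_[p]) ^ i‖ ≤ ‖γ‖ ^ (p ^ i + i) := by
  have hp : 2 ≤ p := (Fact.out : p.Prime).two_le
  have hp0 : (0 : ℝ) < p := by positivity
  have hγ1 : ‖γ‖ ≤ 1 := by
    by_contra! h
    have h1 := one_lt_pow₀ h (show p - 1 ≠ 0 by omega)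
    rw [hγ] at h1
    exact absurd h1 (not_lt.2 (inv_le_one_of_one_le₀ (by exact_mod_cast by omega)))
  have h1 := ((hasSum_nat_add_iff' (i + 1)).2 hsum).tsum_eq
  rw [zero_sub] at h1
  have h2 : gammaSeq p γ i * (p : ℂ_[p]) ^ i
      = - ∑' k, γ ^ p ^ (k + (i + 1)) / (p : ℂ_[p]) ^ (k + (i + 1)) * (p : ℂ_[p]) ^ i := by
    rw [tsum_mul_right, h1, gammaSeq]
    ring
  rw [h2, norm_neg]
  refine norm_tsum_le_of_le (by positivity) fun k => ?_
  rw [norm_mul, norm_div, norm_pow, norm_pow, norm_pow, norm_p]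
  have h3 : ‖γ‖ ^ p ^ (k + (i + 1)) ≤ ‖γ‖ ^ (p ^ i + i) * (p : ℝ)⁻¹ ^ (k + 1) := by
    rw [← hγ, ← pow_mul, ← pow_add]
    refine pow_le_pow_of_le_one (norm_nonneg _) hγ1 ?_
    rw [show k + (i + 1) = i + 1 + k by ring]
    exact le_prime_pow_aux hp i k
  have h4 : (p : ℝ)⁻¹ ^ (k + (i + 1)) = (p : ℝ)⁻¹ ^ (k + 1) * (p : ℝ)⁻¹ ^ i := by
    rw [← pow_add]; congr 1; ring
  rw [h4]
  have h5 : (0 : ℝ) < (p : ℝ)⁻¹ ^ (k + 1) := by positivity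
  have h6 : (0 : ℝ) < (p : ℝ)⁻¹ ^ i := by positivity
  rw [div_mul_eq_mul_div, mul_div_mul_right _ _ h6.ne', div_le_iff₀ h5]
  exact h3

/-! #### The ring `ℤ_p[μ_{q-1}]` -/

/-- Finitely many integral generators give a finite module over the compact ring ℤ_p. -/
theorem isCompact_adjoin {S : Set ℂ_[p]} (hS : S.Finite) (hint : ∀ x ∈ S, IsIntegral (ZpC p) x) :
    IsCompact (Algebra.adjoin (ZpC p) S : Set ℂ_[p]) :=
  Submodule.isCompact_of_fg (fg_adjoin_of_finite hS hint)

theorem norm_le_one_of_mem_adjoin {S : Set ℂ_[p]} (hS : ∀ x ∈ S, ‖x‖ ≤ 1) {x : ℂ_[p]}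
    (hx : x ∈ Algebra.adjoin (ZpC p) S) : ‖x‖ ≤ 1 := by
  induction hx using Algebra.adjoin_induction with
  | mem x hx => exact hS x hx
  | algebraMap r => exact norm_le_one_of_mem_ZpC r.2
  | add x y _ _ hx hy => exact (IsUltrametricDist.norm_add_le_max _ _).trans (max_le hx hy)
  | mul x y _ _ hx hy => rw [norm_mul]; exact mul_le_one₀ hx (norm_nonneg _) hy

variable (p) in
/-- The `(p ^ a - 1)`-st roots of unity in `ℂ_p`. -/
def unityRoots (a : ℕ) : Set ℂ_[p] := {z : ℂ_[p] | z ^ (p ^ a - 1) = 1}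

theorem pow_sub_one_pos {a : ℕ} (ha : 0 < a) : 0 < p ^ a - 1 :=
  Nat.sub_pos_of_lt (Nat.one_lt_pow ha.ne' (Fact.out : p.Prime).one_lt)

theorem finite_unityRoots {a : ℕ} (ha : 0 < a) : (unityRoots p a).Finite := by
  refine (Polynomial.finite_setOfPred_isRoot
    (Polynomial.X_pow_sub_C_ne_zero (pow_sub_one_pos (p := p) ha) (1 : ℂ_[p]))).subset fun z hz => ?_
  simpa [unityRoots, sub_eq_zero] using hz

theorem isIntegral_of_mem_unityRoots {A : Type*} [CommRing A] [Algebra A ℂ_[p]] {a : ℕ}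
    (ha : 0 < a) {z : ℂ_[p]} (hz : z ∈ unityRoots p a) : IsIntegral A z :=
  IsIntegral.of_pow (pow_sub_one_pos ha) (by rw [show z ^ _ = 1 from hz]; exact isIntegral_one)

theorem norm_eq_one_of_mem_unityRoots {a : ℕ} (ha : 0 < a) {z : ℂ_[p]}
    (hz : z ∈ unityRoots p a) : ‖z‖ = 1 := by
  have h : ‖z‖ ^ (p ^ a - 1) = 1 := by rw [← norm_pow, show z ^ _ = 1 from hz, norm_one]
  exact (pow_eq_one_iff_of_nonneg (norm_nonneg _) (pow_sub_one_pos ha).ne').1 h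

variable (p) in
/-- The ring `ℤ_p[μ_{q-1}]`, `q = p ^ a`. -/
def unramInt (a : ℕ) : Subalgebra (ZpC p) ℂ_[p] := Algebra.adjoin (ZpC p) (unityRoots p a)

theorem isCompact_unramInt {a : ℕ} (ha : 0 < a) : IsCompact (unramInt p a : Set ℂ_[p]) :=
  isCompact_adjoin (finite_unityRoots ha) fun _ => isIntegral_of_mem_unityRoots ha

theorem p_mem_unramInt (a : ℕ) : (p : ℂ_[p]) ∈ unramInt p a := natCast_mem _ p

/-- The q-th power map fixes the (q-1)-st roots of unity, is the identity on ℤ_p modulo p, and is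
additive and multiplicative modulo p. -/
theorem exists_pow_eq_add_p_mul {a : ℕ} {w : ℂ_[p]} (hw : w ∈ unramInt p a) :
    ∃ w' ∈ unramInt p a, w ^ p ^ a = w + p * w' := by
  induction hw using Algebra.adjoin_induction with
  | mem x hx =>
    refine ⟨0, zero_mem _, ?_⟩
    rw [mul_zero, add_zero, ← Nat.sub_add_cancel (Nat.one_le_pow a p (Fact.out : p.Prime).pos),
      pow_succ, show x ^ (p ^ a - 1) = 1 from hx, one_mul]
  | algebraMap r =>
    obtain ⟨_, z, rfl⟩ := r
    have h1 : z ^ p ^ a - z ∈ RingHom.ker (PadicInt.toZMod (p := p)) := by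
      rw [RingHom.mem_ker, map_sub, map_pow, ZMod.pow_card_pow, sub_self]
    rw [PadicInt.ker_toZMod, PadicInt.maximalIdeal_eq_span_p, Ideal.mem_span_singleton] at h1
    obtain ⟨z', hz'⟩ := h1
    refine ⟨zpHom p z', (unramInt p a).algebraMap_mem ⟨_, z', rfl⟩, ?_⟩
    change zpHom p z ^ p ^ a = zpHom p z + p * zpHom p z'
    rw [← map_natCast (zpHom p), ← map_mul, ← hz', ← map_add, ← map_pow]
    congr 1
    ring
  | add x y hx hy ihx ihy =>
    obtain ⟨x', hx', ex⟩ := ihx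
    obtain ⟨y', hy', ey⟩ := ihy
    obtain ⟨r, hr⟩ := exists_add_pow_prime_pow_eq (Fact.out : p.Prime)
      (⟨x, hx⟩ : unramInt p a) ⟨y, hy⟩ a
    have hr' := congrArg Subtype.val hr
    simp only [MulMemClass.coe_mul, AddMemClass.coe_add, SubmonoidClass.coe_pow,
      SubringClass.coe_natCast] at hr'
    refine ⟨x' + y' + x * y * r, add_mem (add_mem hx' hy') (mul_mem (mul_mem hx hy) r.2), ?_⟩
    rw [hr', ex, ey]
    ring
  | mul x y hx hy ihx ihy =>
    obtain ⟨x', hx', ex⟩ := ihx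
    obtain ⟨y', hy', ey⟩ := ihy
    refine ⟨x * y' + x' * y + p * x' * y', add_mem (add_mem (mul_mem hx hy') (mul_mem hx' hy))
      (mul_mem (mul_mem (p_mem_unramInt a) hx') hy'), ?_⟩
    rw [mul_pow, ex, ey]
    ring

/-- The differences w - w^(q^k) are all divisible by p in the ring and tend to w. The multiples of p
form a compact, hence closed, set. -/
theorem exists_eq_p_mul_of_norm_lt_one {a : ℕ} (ha : 0 < a) {w : ℂ_[p]} (hw : w ∈ unramInt p a)
    (h : ‖w‖ < 1) : ∃ w' ∈ unramInt p a, w = p * w' := by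
  have hcl : IsClosed ((fun x : ℂ_[p] => p * x) '' (unramInt p a : Set ℂ_[p])) :=
    ((isCompact_unramInt ha).image (by fun_prop)).isClosed
  have hmem : ∀ k : ℕ, w - w ^ (p ^ a) ^ k ∈
      (fun x : ℂ_[p] => p * x) '' (unramInt p a : Set ℂ_[p]) := by
    intro k
    induction k with
    | zero => exact ⟨0, zero_mem _, by simp⟩
    | succ k ih =>
      obtain ⟨x, hx, ex⟩ := ih
      obtain ⟨y, hy, ey⟩ := exists_pow_eq_add_p_mul (pow_mem hw ((p ^ a) ^ k))
      refine ⟨x - y, sub_mem hx hy, ?_⟩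
      simp only at ex ⊢
      rw [mul_sub, ex, pow_succ, pow_mul, ey]
      ring
  have hlim : Tendsto (fun k : ℕ => w - w ^ (p ^ a) ^ k) atTop (𝓝 (w - 0)) := by
    refine tendsto_const_nhds.sub ?_
    exact (tendsto_pow_atTop_nhds_zero_of_norm_lt_one h).comp
      (tendsto_pow_atTop_atTop_of_one_lt (Nat.one_lt_pow ha.ne' (Fact.out : p.Prime).one_lt))
  rw [sub_zero] at hlim
  obtain ⟨w', hw', e⟩ := hcl.mem_of_tendsto hlim (Eventually.of_forall hmem)
  exact ⟨w', hw', e.symm⟩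

theorem exists_eq_p_pow_mul {a : ℕ} (ha : 0 < a) (m : ℕ) {w : ℂ_[p]} (hw : w ∈ unramInt p a)
    (h : ‖w‖ ≤ ‖(p : ℂ_[p])‖ ^ m) : ∃ w' ∈ unramInt p a, w = p ^ m * w' := by
  induction m with
  | zero => exact ⟨w, hw, by simp⟩
  | succ m ih =>
    have hp := norm_p_lt_one (p := p)
    have hp0 : 0 < ‖(p : ℂ_[p])‖ := norm_pos_iff.2 p_ne_zero
    obtain ⟨w', hw', rfl⟩ := ih (h.trans (pow_le_pow_of_le_one hp0.le hp.le (Nat.le_succ m)))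
    rw [norm_mul, norm_pow, pow_succ] at h
    obtain ⟨w'', hw'', rfl⟩ := exists_eq_p_mul_of_norm_lt_one ha hw'
      ((le_of_mul_le_mul_left h (pow_pos hp0 m)).trans_lt hp)
    exact ⟨w'', hw'', by ring⟩

theorem exists_p_pow_mul_mem_unramInt {a : ℕ} (ha : 0 < a) {z : ℂ_[p]} (hz : z ∈ Qq p a) :
    ∃ m : ℕ, (p : ℂ_[p]) ^ m * z ∈ unramInt p a := by
  have h1 : z ∈ Algebra.adjoin ℚ_[p] (unityRoots p a) := by
    rw [← IntermediateField.adjoin_toSubalgebra_of_isAlgebraic]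
    · exact hz
    · exact fun x hx => (isIntegral_of_mem_unityRoots ha hx).isAlgebraic
  clear hz
  induction h1 using Algebra.adjoin_induction with
  | mem x hx => exact ⟨0, by rw [pow_zero, one_mul]; exact Algebra.subset_adjoin hx⟩
  | algebraMap r =>
    have hp : ‖(p : ℚ_[p])‖ < 1 := Padic.norm_p_lt_one
    obtain ⟨m, hm⟩ := exists_pow_lt_of_lt_one (show (0 : ℝ) < (‖r‖ + 1)⁻¹ by positivity) hp
    have h2 : ‖(p : ℚ_[p]) ^ m * r‖ ≤ 1 := by
      rw [norm_mul, norm_pow]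
      calc _ ≤ (‖r‖ + 1)⁻¹ * (‖r‖ + 1) :=
            mul_le_mul hm.le (by linarith) (norm_nonneg _) (by positivity)
        _ = 1 := inv_mul_cancel₀ (by positivity)
    refine ⟨m, ?_⟩
    have h3 := (unramInt p a).algebraMap_mem ⟨_, ⟨_, h2⟩, rfl⟩
    change algebraMap ℚ_[p] ℂ_[p] ((p : ℚ_[p]) ^ m * r) ∈ unramInt p a at h3
    rwa [map_mul, map_pow, map_natCast] at h3
  | add x y hx hy ihx ihy =>
    obtain ⟨m, hm⟩ := ihx
    obtain ⟨l, hl⟩ := ihy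
    refine ⟨m + l, ?_⟩
    have := add_mem (mul_mem (pow_mem (p_mem_unramInt a) l) hm)
      (mul_mem (pow_mem (p_mem_unramInt a) m) hl)
    convert this using 1
    ring
  | mul x y hx hy ihx ihy =>
    obtain ⟨m, hm⟩ := ihx
    obtain ⟨l, hl⟩ := ihy
    refine ⟨m + l, ?_⟩
    convert mul_mem hm hl using 1
    ring

/-- Thus ℤ_q = ℤ_p[μ_(q-1)]: clear the denominator by a power of p, then divide it out again using
the norm. -/
theorem mem_unramInt_of_mem_Qq {a : ℕ} (ha : 0 < a) {z : ℂ_[p]} (hz : z ∈ Qq p a) (h : ‖z‖ ≤ 1) :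
    z ∈ unramInt p a := by
  obtain ⟨m, hm⟩ := exists_p_pow_mul_mem_unramInt ha hz
  obtain ⟨w, hw, e⟩ := exists_eq_p_pow_mul ha m hm (by
    rw [norm_mul, norm_pow]
    exact mul_le_of_le_one_right (by positivity) h)
  rwa [mul_left_cancel₀ (pow_ne_zero m p_ne_zero) e]

theorem norm_coe_Zq_le_one {a : ℕ} (z : Zq p a) : ‖((z : Qq p a) : ℂ_[p])‖ ≤ 1 := z.2

/-! #### The structure of `ℤ_q[g]` -/

theorem coe_Zq_mem_ZqAdjoin {a : ℕ} (g : ℂ_[p]) (z : Zq p a) :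
    ((z : Qq p a) : ℂ_[p]) ∈ ZqAdjoin p a g :=
  (Algebra.adjoin (Zq p a) {g}).algebraMap_mem z

theorem mem_ZqAdjoin_of_mem_Qq {a : ℕ} (g : ℂ_[p]) {z : ℂ_[p]} (hz : z ∈ Qq p a) (h : ‖z‖ ≤ 1) :
    z ∈ ZqAdjoin p a g :=
  coe_Zq_mem_ZqAdjoin g ⟨⟨z, hz⟩, h⟩

theorem self_mem_ZqAdjoin (a : ℕ) (g : ℂ_[p]) : g ∈ ZqAdjoin p a g :=
  Algebra.subset_adjoin (Set.mem_singleton g)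

/-- A description by finitely many generators over ℤ_p, from which compactness of ℤ_q[g] will
follow. -/
theorem mem_ZqAdjoin_iff {a : ℕ} (ha : 0 < a) (g x : ℂ_[p]) :
    x ∈ ZqAdjoin p a g ↔ x ∈ Algebra.adjoin (ZpC p) (unityRoots p a ∪ {g}) := by
  constructor
  · intro hx
    change x ∈ Algebra.adjoin (Zq p a) {g} at hx
    induction hx using Algebra.adjoin_induction with
    | mem x hx => exact Algebra.subset_adjoin (Or.inr hx)
    | algebraMap r =>
      exact Algebra.adjoin_mono Set.subset_union_left
        (mem_unramInt_of_mem_Qq ha (r : Qq p a).2 (norm_coe_Zq_le_one r))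
    | add x y _ _ hx hy => exact add_mem hx hy
    | mul x y _ _ hx hy => exact mul_mem hx hy
  · intro hx
    induction hx using Algebra.adjoin_induction with
    | mem x hx =>
      rcases hx with hx | rfl
      · exact mem_ZqAdjoin_of_mem_Qq g (IntermediateField.subset_adjoin _ _ hx)
          (norm_eq_one_of_mem_unityRoots ha hx).le
      · exact self_mem_ZqAdjoin a x
    | algebraMap r =>
      obtain ⟨_, z, rfl⟩ := r
      exact mem_ZqAdjoin_of_mem_Qq g ((Qq p a).algebraMap_mem (z : ℚ_[p]))
        (norm_le_one_of_mem_ZpC ⟨z, rfl⟩)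
    | add x y _ _ hx hy => exact add_mem hx hy
    | mul x y _ _ hx hy => exact mul_mem hx hy

variable (p) in
/-- `ℤ_q[g]` is a closed subring of the unit ball, with `g` as a uniformizer. -/
structure IsUnif (a : ℕ) (g : ℂ_[p]) : Prop where
  ne_zero : g ≠ 0
  norm_lt_one : ‖g‖ < 1
  isClosed : IsClosed (ZqAdjoin p a g : Set ℂ_[p])
  norm_le_one : ∀ r ∈ ZqAdjoin p a g, ‖r‖ ≤ 1
  exists_eq_mul : ∀ r ∈ ZqAdjoin p a g, ‖r‖ < 1 → ∃ r' ∈ ZqAdjoin p a g, r = g * r'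

/-- The equation g^N = py makes g integral over ℤ_p and a divisor of p in ℤ_q[g], as for a root of
an Eisenstein polynomial. -/
theorem isUnif_of_pow_eq {a : ℕ} (ha : 0 < a) {g y : ℂ_[p]} {N : ℕ} (hN : 0 < N)
    (hy : y ∈ ZpC p) (hy1 : ‖y‖ = 1) (hg : g ^ N = p * y) : IsUnif p a g := by
  have hy0 : y ≠ 0 := norm_pos_iff.1 (by rw [hy1]; exact one_pos)
  have hgN : ‖g‖ ^ N = ‖(p : ℂ_[p])‖ := by rw [← norm_pow, hg, norm_mul, hy1, mul_one]
  have hg1 : ‖g‖ < 1 := by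
    by_contra! h
    exact absurd (hgN ▸ norm_p_lt_one) (not_lt.2 (one_le_pow₀ h))
  have hset : (ZqAdjoin p a g : Set ℂ_[p]) = Algebra.adjoin (ZpC p) (unityRoots p a ∪ {g}) :=
    Set.ext (mem_ZqAdjoin_iff ha g)
  refine ⟨?_, hg1, ?_, ?_, ?_⟩
  · rintro rfl
    rw [zero_pow hN.ne'] at hg
    exact mul_ne_zero p_ne_zero hy0 hg.symm
  · rw [hset]
    refine (isCompact_adjoin ((finite_unityRoots ha).union (Set.finite_singleton g)) ?_).isClosed
    rintro x (hx | rfl)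
    · exact isIntegral_of_mem_unityRoots ha hx
    · refine IsIntegral.of_pow hN ?_
      rw [hg]
      exact isIntegral_algebraMap
        (x := (⟨p * y, (ZpC p).mul_mem (natCast_mem _ p) hy⟩ : ZpC p))
  · intro r hr
    rw [mem_ZqAdjoin_iff ha] at hr
    refine norm_le_one_of_mem_adjoin ?_ hr
    rintro x (hx | rfl)
    · exact (norm_eq_one_of_mem_unityRoots ha hx).le
    · exact hg1.le
  · have hp : ∃ r' ∈ ZqAdjoin p a g, (p : ℂ_[p]) = g * r' := by
      obtain ⟨z, hz⟩ := inv_mem_ZpC hy hy1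
      refine ⟨g ^ (N - 1) * y⁻¹, mul_mem (pow_mem (self_mem_ZqAdjoin a g) _) ?_, ?_⟩
      · rw [← hz]
        exact mem_ZqAdjoin_of_mem_Qq g ((Qq p a).algebraMap_mem (z : ℚ_[p]))
          (norm_le_one_of_mem_ZpC ⟨z, rfl⟩)
      · rw [← mul_assoc, ← pow_succ', Nat.sub_add_cancel hN, hg, mul_assoc, mul_inv_cancel₀ hy0,
          mul_one]
    -- Modulo g every element comes from ℤ_p[μ_(q-1)]. There an element of norm less than 1 is
    -- divisible by p, hence by g.
    have hdec : ∀ r ∈ Algebra.adjoin (ZpC p) (unityRoots p a ∪ {g}),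
        ∃ w ∈ unramInt p a, ∃ r' ∈ ZqAdjoin p a g, r = w + g * r' := by
      intro r hr
      have hle : ∀ {w}, w ∈ unramInt p a → w ∈ ZqAdjoin p a g := fun hw =>
        (mem_ZqAdjoin_iff ha g _).2 (Algebra.adjoin_mono Set.subset_union_left hw)
      induction hr using Algebra.adjoin_induction with
      | mem x hx =>
        rcases hx with hx | rfl
        · exact ⟨x, Algebra.subset_adjoin hx, 0, zero_mem _, by simp⟩
        · exact ⟨0, zero_mem _, 1, one_mem _, by simp⟩
      | algebraMap r => exact ⟨_, (unramInt p a).algebraMap_mem r, 0, zero_mem _, by simp⟩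
      | add x y _ _ hx hy =>
        obtain ⟨w, hw, r, hr, rfl⟩ := hx
        obtain ⟨w', hw', r', hr', rfl⟩ := hy
        exact ⟨w + w', add_mem hw hw', r + r', add_mem hr hr', by ring⟩
      | mul x y _ _ hx hy =>
        obtain ⟨w, hw, r, hr, rfl⟩ := hx
        obtain ⟨w', hw', r', hr', rfl⟩ := hy
        refine ⟨w * w', mul_mem hw hw', w * r' + r * w' + g * r * r', ?_, by ring⟩
        exact add_mem (add_mem (mul_mem (hle hw) hr') (mul_mem hr (hle hw')))
          (mul_mem (mul_mem (self_mem_ZqAdjoin a g) hr) hr')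
    intro r hr h
    obtain ⟨w, hw, r', hr', rfl⟩ := hdec r ((mem_ZqAdjoin_iff ha g r).1 hr)
    have hr1 : ‖r'‖ ≤ 1 := by
      refine norm_le_one_of_mem_adjoin ?_ ((mem_ZqAdjoin_iff ha g r').1 hr')
      rintro x (hx | rfl)
      · exact (norm_eq_one_of_mem_unityRoots ha hx).le
      · exact hg1.le
    have hw1 : ‖w‖ < 1 := by
      have h1 : w = (w + g * r') + -(g * r') := by ring
      rw [h1]
      refine (IsUltrametricDist.norm_add_le_max _ _).trans_lt (max_lt h ?_)
      rw [norm_neg, norm_mul]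
      exact (mul_le_of_le_one_right (norm_nonneg _) hr1).trans_lt hg1
    obtain ⟨w', hw', rfl⟩ := exists_eq_p_mul_of_norm_lt_one ha hw hw1
    obtain ⟨s, hs, hps⟩ := hp
    refine ⟨s * w' + r', add_mem (mul_mem hs ?_) hr', ?_⟩
    · exact (mem_ZqAdjoin_iff ha g _).2 (Algebra.adjoin_mono Set.subset_union_left hw')
    · rw [hps]; ring

theorem IsUnif.exists_eq_pow_mul {a : ℕ} {g : ℂ_[p]} (hg : IsUnif p a g) (m : ℕ) {r : ℂ_[p]}
    (hr : r ∈ ZqAdjoin p a g) (h : ‖r‖ ≤ ‖g‖ ^ m) : ∃ r' ∈ ZqAdjoin p a g, r = g ^ m * r' := by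
  induction m with
  | zero => exact ⟨r, hr, by simp⟩
  | succ m ih =>
    have hg0 : 0 < ‖g‖ := norm_pos_iff.2 hg.ne_zero
    obtain ⟨w', hw', rfl⟩ :=
      ih (h.trans (pow_le_pow_of_le_one hg0.le hg.norm_lt_one.le (Nat.le_succ m)))
    rw [norm_mul, norm_pow, pow_succ] at h
    obtain ⟨w'', hw'', rfl⟩ := hg.exists_eq_mul w' hw'
      ((le_of_mul_le_mul_left h (pow_pos hg0 m)).trans_lt hg.norm_lt_one)
    exact ⟨w'', hw'', by ring⟩

theorem isUnif_of_pow_eq_gamma {a n : ℕ} (ha : 0 < a) (hn : 0 < n) {g γ : ℂ_[p]} (hg : g ^ n = γ)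
    (hγ : ‖γ‖ ^ (p - 1) = (p : ℝ)⁻¹)
    (hsum : HasSum (fun k : ℕ => γ ^ p ^ k / (p : ℂ_[p]) ^ k) 0) : IsUnif p a g := by
  have hp : 2 ≤ p := (Fact.out : p.Prime).two_le
  refine isUnif_of_pow_eq ha (N := n * (p - 1)) (Nat.mul_pos hn (by omega))
    (gamma_pow_div_mem_ZpC hγ hsum) ?_ ?_
  · rw [norm_div, norm_pow, hγ, norm_p, div_self (by positivity)]
  · rw [pow_mul, hg, mul_div_cancel₀ _ p_ne_zero]

/-- The factor g^(n p^i) pays for the weight n p^i of the i-th monomials of D_x and D_y; g^(n i)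
remains and makes the series converge g-adically. -/
theorem exists_gammaSeq_mul_eq {a n : ℕ} {g γ : ℂ_[p]} (hu : IsUnif p a g) (hg : g ^ n = γ)
    (hγ : ‖γ‖ ^ (p - 1) = (p : ℝ)⁻¹)
    (hsum : HasSum (fun k : ℕ => γ ^ p ^ k / (p : ℂ_[p]) ^ k) 0) (i : ℕ) :
    ∃ r ∈ ZqAdjoin p a g, gammaSeq p γ i * (p : ℂ_[p]) ^ i = r * g ^ (n * i) * g ^ (n * p ^ i) := by
  have hmem : gammaSeq p γ i * (p : ℂ_[p]) ^ i ∈ ZqAdjoin p a g := by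
    rw [gammaSeq, Finset.sum_mul]
    refine sum_mem fun k hk => ?_
    obtain ⟨j, rfl⟩ := Nat.exists_eq_add_of_le (Nat.lt_succ_iff.1 (Finset.mem_range.1 hk))
    rw [pow_add, ← mul_assoc, div_mul_cancel₀ _ (pow_ne_zero _ p_ne_zero), ← hg]
    exact mul_mem (pow_mem (pow_mem (self_mem_ZqAdjoin a g) _) _) (pow_mem (natCast_mem _ p) _)
  obtain ⟨r, hr, e⟩ := hu.exists_eq_pow_mul (n * (p ^ i + i)) hmem (by
    rw [pow_mul, ← norm_pow, hg]
    exact norm_gammaSeq_mul_le hγ hsum i)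
  refine ⟨r, hr, ?_⟩
  rw [e, mul_add, pow_add]
  ring

end RingFacts

/-! ### The weight function, continued -/

section Weight

theorem mMax_nonneg (u : ℤ × ℤ) : 0 ≤ mMax u := le_max_left _ _

theorem neg_fst_le_mMax (u : ℤ × ℤ) : -u.1 ≤ mMax u :=
  (le_max_left _ _).trans (le_max_right _ _)

theorem neg_snd_le_mMax (u : ℤ × ℤ) : -u.2 ≤ mMax u :=
  (le_max_right _ _).trans (le_max_right _ _)

theorem mMax_le_add (u v : ℤ × ℤ) : mMax u ≤ mMax (u - v) + mMax v := by
  have h1 := neg_fst_le_mMax (u - v)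
  have h2 := neg_snd_le_mMax (u - v)
  have h3 := neg_fst_le_mMax v
  have h4 := neg_snd_le_mMax v
  rw [Prod.fst_sub] at h1
  rw [Prod.snd_sub] at h2
  exact max_le (add_nonneg (mMax_nonneg _) (mMax_nonneg _)) (max_le (by linarith) (by linarith))

theorem intCast_wt (n : ℕ) (u : ℤ × ℤ) :
    (wt n u : ℤ) = (u.1 + mMax u) + n * ((u.2 + mMax u) + mMax u) := by
  have h1 := mMax_nonneg u
  have h2 := neg_fst_le_mMax u
  have h3 := neg_snd_le_mMax u
  have h4 : 0 ≤ (n : ℤ) * ((u.2 + mMax u) + mMax u) :=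
    mul_nonneg (by positivity) (by linarith)
  have h5 : u.1 + n * u.2 + (2 * n + 1) * mMax u
      = (u.1 + mMax u) + n * ((u.2 + mMax u) + mMax u) := by ring
  rw [wt, h5, Int.toNat_of_nonneg (by linarith)]

/-- Subadditivity of the weight, inherited from `mMax`; the excess d becomes a spare power of g in
products. -/
theorem exists_wt_sub_add_wt (n : ℕ) (u v : ℤ × ℤ) : ∃ d : ℕ, wt n (u - v) + wt n v = wt n u + d := by
  refine Nat.exists_eq_add_of_le ?_
  have h := mMax_le_add u v
  zify
  rw [intCast_wt, intCast_wt, intCast_wt, Prod.fst_sub, Prod.snd_sub]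
  nlinarith [mul_nonneg (Int.natCast_nonneg n) (sub_nonneg.2 h)]

theorem wt_natCast_zero (n m : ℕ) : wt n ((m : ℤ), 0) = m := by
  have h : mMax ((m : ℤ), (0 : ℤ)) = 0 := by simp [mMax]
  zify
  rw [intCast_wt, h]
  simp

theorem wt_zero_natCast (n m : ℕ) : wt n (0, (m : ℤ)) = n * m := by
  have h : mMax ((0 : ℤ), (m : ℤ)) = 0 := by simp [mMax]
  zify
  rw [intCast_wt, h]
  simp

theorem wt_neg_natCast (n m : ℕ) : wt n (-(m : ℤ), -(m : ℤ)) = n * m := by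
  have h : mMax (-(m : ℤ), -(m : ℤ)) = m := by simp [mMax]
  zify
  rw [intCast_wt, h]
  simp

theorem finite_wt_lt {n : ℕ} (hn : 0 < n) (B : ℕ) : {u : ℤ × ℤ | wt n u < B}.Finite := by
  refine ((Set.finite_Icc (-(B : ℤ)) B).prod (Set.finite_Icc (-(B : ℤ)) B)).subset fun u hu => ?_
  have h0 : (wt n u : ℤ) < B := by exact_mod_cast hu
  have h1 := mMax_nonneg u
  have h2 := neg_fst_le_mMax u
  have h3 := neg_snd_le_mMax u
  have hn' : (1 : ℤ) ≤ n := by exact_mod_cast hn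
  have h4 : (1 : ℤ) * ((u.2 + mMax u) + mMax u) ≤ n * ((u.2 + mMax u) + mMax u) :=
    mul_le_mul_of_nonneg_right hn' (by linarith)
  rw [intCast_wt] at h0
  simp only [Set.mem_prod, Set.mem_Icc]
  refine ⟨⟨?_, ?_⟩, ?_, ?_⟩ <;> linarith

/-- Only finitely many exponents have weight below a given bound. -/
theorem comap_omega_atTop {n : ℕ} (hn : 0 < n) :
    comap (omega n) atTop = (cofinite : Filter (ℤ × ℤ)) := by
  refine le_antisymm ?_ ?_
  · refine le_cofinite_iff_compl_singleton_mem.2 fun u => ?_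
    have h : ∀ᶠ v in comap (omega n) atTop, omega n u < omega n v :=
      tendsto_comap.eventually (eventually_gt_atTop (omega n u))
    filter_upwards [h] with v hv
    rintro rfl
    exact lt_irrefl _ hv
  · rw [← tendsto_iff_comap, tendsto_atTop]
    intro b
    obtain ⟨B, hB⟩ := exists_nat_ge (n * b)
    refine (finite_wt_lt hn B).subset fun u hu => ?_
    have h1 : omega n u < b := not_le.1 hu
    have hn' : (0 : ℚ) < n := by exact_mod_cast hn
    have h2 : (wt n u : ℚ) < B := by
      rw [natCast_wt n hn]
      exact (mul_lt_mul_of_pos_left h1 hn').trans_le hB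
    exact_mod_cast h2

end Weight

/-! ### Multiplication operators on `C₀` -/

section Operators

variable {p : ℕ} [Fact p.Prime] {a n : ℕ} {g : ℂ_[p]}

theorem mem_C0_iff (hu : IsUnif p a g) (hn : 0 < n) (c : ℤ × ℤ → ℂ_[p]) :
    c ∈ C0 p a n g ↔ (∀ u, c u / g ^ wt n u ∈ ZqAdjoin p a g) ∧
      Tendsto (fun u => c u / g ^ wt n u) cofinite (𝓝 0) := by
  have hg : ∀ u, g ^ wt n u ≠ 0 := fun u => pow_ne_zero _ hu.ne_zero
  constructor
  · rintro ⟨ξ, hξ, hc⟩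
    have h : ∀ u, c u / g ^ wt n u = ξ u := fun u => by rw [hc, mul_div_cancel_right₀ _ (hg u)]
    simp only [h]
    refine ⟨fun u => (ξ u).2, ?_⟩
    rw [comap_omega_atTop hn] at hξ
    exact tendsto_zero_iff_norm_tendsto_zero.2 hξ
  · rintro ⟨h1, h2⟩
    refine ⟨fun u => ⟨_, h1 u⟩, ?_, fun u => (div_mul_cancel₀ _ (hg u)).symm⟩
    rw [comap_omega_atTop hn]
    exact tendsto_zero_iff_norm_tendsto_zero.1 h2

theorem norm_le_one_of_mem_C0 (hu : IsUnif p a g) {c : ℤ × ℤ → ℂ_[p]} (hc : c ∈ C0 p a n g)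
    (u : ℤ × ℤ) : ‖c u‖ ≤ 1 := by
  obtain ⟨ξ, -, hξ⟩ := hc
  rw [hξ, norm_mul, norm_pow]
  exact mul_le_one₀ (hu.norm_le_one _ (ξ u).2) (by positivity)
    (pow_le_one₀ (norm_nonneg _) hu.norm_lt_one.le)

/-- The series `∑ b(i) x^{v(i)}` has coefficients in `g^i g^{nω} ℤ_q[g]`. -/
def IsAdm (p : ℕ) [Fact p.Prime] (a n : ℕ) (g : ℂ_[p]) (b : ℕ → ℂ_[p]) (v : ℕ → ℤ × ℤ) : Prop :=
  ∀ i, ∃ r ∈ ZqAdjoin p a g, b i = r * g ^ i * g ^ wt n (v i)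

theorem IsAdm.mul_left {b : ℕ → ℂ_[p]} {v : ℕ → ℤ × ℤ} (h : IsAdm p a n g b v) {r : ℕ → ℂ_[p]}
    (hr : ∀ i, r i ∈ ZqAdjoin p a g) : IsAdm p a n g (fun i => r i * b i) v := by
  intro i
  obtain ⟨s, hs, e⟩ := h i
  exact ⟨r i * s, mul_mem (hr i) hs, by simp only [e]; ring⟩

theorem IsAdm.norm_le (hu : IsUnif p a g) {b : ℕ → ℂ_[p]} {v : ℕ → ℤ × ℤ}
    (h : IsAdm p a n g b v) (i : ℕ) : ‖b i‖ ≤ ‖g‖ ^ i := by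
  obtain ⟨s, hs, e⟩ := h i
  rw [e, norm_mul, norm_mul, norm_pow, norm_pow]
  refine (mul_le_of_le_one_right (by positivity)
    (pow_le_one₀ (norm_nonneg _) hu.norm_lt_one.le)).trans ?_
  exact mul_le_of_le_one_left (by positivity) (hu.norm_le_one s hs)

theorem IsAdm.summable_norm (hu : IsUnif p a g) {b : ℕ → ℂ_[p]} {v : ℕ → ℤ × ℤ}
    (h : IsAdm p a n g b v) : Summable fun i => ‖b i‖ :=
  (summable_geometric_of_lt_one (norm_nonneg _) hu.norm_lt_one).of_nonneg_of_le
    (fun _ => norm_nonneg _) (h.norm_le hu)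

/-- Multiplication by the series `∑ b(i) x^{v(i)}`. -/
def shiftSum (b : ℕ → ℂ_[p]) (v : ℕ → ℤ × ℤ) (c : ℤ × ℤ → ℂ_[p]) : ℤ × ℤ → ℂ_[p] :=
  fun u => ∑' i, b i * c (u - v i)

theorem summable_shift {b : ℕ → ℂ_[p]} (hb : Summable fun i => ‖b i‖) (v : ℕ → ℤ × ℤ)
    {c : ℤ × ℤ → ℂ_[p]} (hc : ∀ u, ‖c u‖ ≤ 1) (u : ℤ × ℤ) :
    Summable fun i => b i * c (u - v i) := by
  refine Summable.of_norm_bounded hb fun i => ?_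
  rw [norm_mul]
  exact mul_le_of_le_one_right (norm_nonneg _) (hc _)

/-- By subadditivity each normalised term is an element of ℤ_q[g] of norm at most |g|^i times a
normalised coefficient of c. Closedness gives integrality of the sum, dominated convergence its
decay. -/
theorem shiftSum_mem (hu : IsUnif p a g) (hn : 0 < n) {b : ℕ → ℂ_[p]} {v : ℕ → ℤ × ℤ}
    (h : IsAdm p a n g b v) {c : ℤ × ℤ → ℂ_[p]} (hc : c ∈ C0 p a n g) :
    shiftSum b v c ∈ C0 p a n g := by
  have hc1 := norm_le_one_of_mem_C0 hu hc
  rw [mem_C0_iff hu hn] at hc ⊢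
  obtain ⟨h1, h2⟩ := hc
  have hterm : ∀ u i, ∃ r ∈ ZqAdjoin p a g, ‖r‖ ≤ ‖g‖ ^ i ∧
      b i * c (u - v i) / g ^ wt n u = r * (c (u - v i) / g ^ wt n (u - v i)) := by
    intro u i
    obtain ⟨r, hr, e⟩ := h i
    obtain ⟨d, hd⟩ := exists_wt_sub_add_wt n u (v i)
    have hgi : ∀ m, g ^ m ∈ ZqAdjoin p a g := fun m => pow_mem (self_mem_ZqAdjoin a g) m
    refine ⟨r * g ^ d * g ^ i, mul_mem (mul_mem hr (hgi d)) (hgi i), ?_, ?_⟩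
    · rw [norm_mul, norm_pow]
      exact mul_le_of_le_one_left (by positivity) (hu.norm_le_one _ (mul_mem hr (hgi d)))
    · have hg : ∀ m, g ^ m ≠ 0 := fun m => pow_ne_zero _ hu.ne_zero
      have hd' : g ^ wt n (u - v i) * g ^ wt n (v i) = g ^ wt n u * g ^ d := by
        rw [← pow_add, hd, pow_add]
      rw [e, div_eq_iff (hg _), mul_div_assoc', div_mul_eq_mul_div, eq_div_iff (hg _)]
      linear_combination (r * g ^ i * c (u - v i)) * hd'
  choose r hr hrn hre using hterm
  have hdiv : ∀ u, shiftSum b v c u / g ^ wt n u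
      = ∑' i, r u i * (c (u - v i) / g ^ wt n (u - v i)) := by
    intro u
    rw [shiftSum, ← tsum_div_const]
    exact tsum_congr fun i => hre u i
  simp only [hdiv]
  refine ⟨fun u => tsum_mem_of_isClosed hu.isClosed fun i => mul_mem (hr u i) (h1 _), ?_⟩
  have hlim := tendsto_tsum_of_dominated_convergence (𝓕 := (cofinite : Filter (ℤ × ℤ)))
    (f := fun u i => r u i * (c (u - v i) / g ^ wt n (u - v i))) (g := fun _ => (0 : ℂ_[p]))
    (bound := fun i => ‖g‖ ^ i)
    (summable_geometric_of_lt_one (norm_nonneg _) hu.norm_lt_one) ?_ ?_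
  · simpa using hlim
  · intro i
    have h3 : Tendsto (fun u => c (u - v i) / g ^ wt n (u - v i)) cofinite (𝓝 0) :=
      h2.comp (sub_left_injective (b := v i)).tendsto_cofinite
    refine squeeze_zero_norm (fun u => ?_) (tendsto_zero_iff_norm_tendsto_zero.1 h3)
    rw [norm_mul]
    exact mul_le_of_le_one_left (norm_nonneg _) (hu.norm_le_one _ (hr u i))
  · refine Eventually.of_forall fun u i => ?_
    rw [norm_mul]
    exact (mul_le_of_le_one_right (norm_nonneg _) (hu.norm_le_one _ (h1 _))).trans (hrn u i)

/-- Multiplication by the series `∑ b(i) x^{v(i)}` on `C₀`. -/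
def shiftLin (hu : IsUnif p a g) (hn : 0 < n) {b : ℕ → ℂ_[p]} {v : ℕ → ℤ × ℤ}
    (h : IsAdm p a n g b v) : Module.End (ZqAdjoin p a g) (C0 p a n g) where
  toFun c := ⟨shiftSum b v c, shiftSum_mem hu hn h c.2⟩
  map_add' c d := by
    ext u
    have hs := fun c : C0 p a n g => summable_shift (h.summable_norm hu) v
      (norm_le_one_of_mem_C0 hu c.2) u
    change ∑' i, b i * ((c : ℤ × ℤ → ℂ_[p]) (u - v i) + (d : ℤ × ℤ → ℂ_[p]) (u - v i)) = _ + _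
    simp only [mul_add]
    exact (hs c).tsum_add (hs d)
  map_smul' r c := by
    ext u
    change ∑' i, b i * ((r : ℂ_[p]) * (c : ℤ × ℤ → ℂ_[p]) (u - v i))
      = (r : ℂ_[p]) * ∑' i, b i * (c : ℤ × ℤ → ℂ_[p]) (u - v i)
    rw [← tsum_mul_left]
    exact tsum_congr fun i => by ring

theorem shiftLin_apply (hu : IsUnif p a g) (hn : 0 < n) {b : ℕ → ℂ_[p]} {v : ℕ → ℤ × ℤ}
    (h : IsAdm p a n g b v) (c : C0 p a n g) (u : ℤ × ℤ) :
    (shiftLin hu hn h c : ℤ × ℤ → ℂ_[p]) u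
      = ∑' i, b i * (c : ℤ × ℤ → ℂ_[p]) (u - v i) := rfl

/-- The diagonal operator multiplying the coefficient at `u` by the integer `f u`. -/
def diagLin (hu : IsUnif p a g) (hn : 0 < n) (f : ℤ × ℤ → ℤ) :
    Module.End (ZqAdjoin p a g) (C0 p a n g) where
  toFun c := ⟨fun u => (f u : ℂ_[p]) * (c : ℤ × ℤ → ℂ_[p]) u, by
    have hc := c.2
    rw [mem_C0_iff hu hn] at hc ⊢
    simp only [mul_div_assoc]
    refine ⟨fun u => mul_mem (intCast_mem _ _) (hc.1 u), ?_⟩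
    refine squeeze_zero_norm (fun u => ?_) (tendsto_zero_iff_norm_tendsto_zero.1 hc.2)
    rw [norm_mul]
    exact mul_le_of_le_one_left (norm_nonneg _)
      (hu.norm_le_one _ (intCast_mem (ZqAdjoin p a g) _))⟩
  map_add' c d := by
    ext u
    exact mul_add _ _ _
  map_smul' r c := by
    ext u
    exact mul_left_comm _ _ _

theorem shiftLin_comm (hu : IsUnif p a g) (hn : 0 < n) {b b' : ℕ → ℂ_[p]} {v v' : ℕ → ℤ × ℤ}
    (h : IsAdm p a n g b v) (h' : IsAdm p a n g b' v') :
    shiftLin hu hn h * shiftLin hu hn h' = shiftLin hu hn h' * shiftLin hu hn h := by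
  ext c u
  have hc := norm_le_one_of_mem_C0 hu c.2
  change ∑' i, b i * ∑' j, b' j * (c : ℤ × ℤ → ℂ_[p]) (u - v i - v' j)
    = ∑' j, b' j * ∑' i, b i * (c : ℤ × ℤ → ℂ_[p]) (u - v' j - v i)
  simp only [← tsum_mul_left]
  rw [Summable.tsum_comm]
  · refine tsum_congr fun j => tsum_congr fun i => ?_
    rw [sub_right_comm]
    ring
  · have hs : Summable fun q : ℕ × ℕ => ‖b' q.1‖ * ‖b q.2‖ :=
      (h'.summable_norm hu).mul_of_nonneg (h.summable_norm hu) (fun i => norm_nonneg (b' i))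
        fun i => norm_nonneg (b i)
    refine Summable.of_norm_bounded hs fun q => ?_
    simp only [Function.uncurry]
    rw [norm_mul, norm_mul, mul_left_comm, ← mul_assoc]
    exact mul_le_of_le_one_right (by positivity) (hc _)

theorem diagLin_comm (hu : IsUnif p a g) (hn : 0 < n) (f f' : ℤ × ℤ → ℤ) :
    diagLin hu hn (a := a) f * diagLin hu hn f' = diagLin hu hn f' * diagLin hu hn f := by
  ext c u
  exact mul_left_comm _ _ _

/-- The Leibniz rule for a diagonal operator with additive eigenvalues. -/
theorem diagLin_mul_shiftLin (hu : IsUnif p a g) (hn : 0 < n) (f : ℤ × ℤ →+ ℤ) {b : ℕ → ℂ_[p]}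
    {v : ℕ → ℤ × ℤ} (h : IsAdm p a n g b v) :
    diagLin hu hn f * shiftLin hu hn h = shiftLin hu hn h * diagLin hu hn f
      + shiftLin hu hn (h.mul_left (r := fun i => (f (v i) : ℂ_[p]))
          fun _ => intCast_mem _ _) := by
  ext c u
  have hc := norm_le_one_of_mem_C0 hu c.2
  have h1 := (diagLin hu hn f c).2
  change (f u : ℂ_[p]) * ∑' i, b i * (c : ℤ × ℤ → ℂ_[p]) (u - v i)
    = ∑' i, b i * ((f (u - v i) : ℂ_[p]) * (c : ℤ × ℤ → ℂ_[p]) (u - v i))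
      + ∑' i, ((f (v i) : ℂ_[p]) * b i) * (c : ℤ × ℤ → ℂ_[p]) (u - v i)
  rw [← Summable.tsum_add, ← tsum_mul_left]
  · refine tsum_congr fun i => ?_
    rw [map_sub]
    push_cast
    ring
  · exact summable_shift (h.summable_norm hu) v (norm_le_one_of_mem_C0 hu h1) u
  · exact summable_shift (IsAdm.summable_norm hu (h.mul_left fun i => intCast_mem _ _)) v hc u

/-- Multiplication by an admissible series is its leading term up to a multiple of `g`. -/
theorem exists_shiftLin_eq (hu : IsUnif p a g) (hn : 0 < n) {b : ℕ → ℂ_[p]} {v : ℕ → ℤ × ℤ}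
    (h : IsAdm p a n g b v) (c : C0 p a n g) :
    ∃ d : C0 p a n g, ∀ u, (shiftLin hu hn h c : ℤ × ℤ → ℂ_[p]) u
      = b 0 * (c : ℤ × ℤ → ℂ_[p]) (u - v 0) + g * (d : ℤ × ℤ → ℂ_[p]) u := by
  have h' : IsAdm p a n g (fun i => b (i + 1) / g) (fun i => v (i + 1)) := by
    intro i
    obtain ⟨r, hr, e⟩ := h (i + 1)
    refine ⟨r, hr, ?_⟩
    simp only [e]
    rw [div_eq_iff hu.ne_zero]
    ring
  refine ⟨shiftLin hu hn h' c, fun u => ?_⟩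
  rw [shiftLin_apply, shiftLin_apply, (summable_shift (h.summable_norm hu) v
    (norm_le_one_of_mem_C0 hu c.2) u).tsum_eq_zero_add, ← tsum_mul_left]
  congr 1
  refine tsum_congr fun i => ?_
  rw [← mul_assoc, mul_div_cancel₀ _ hu.ne_zero]

end Operators

/-! ### Lifting from the reduction -/

section Lifting

variable {R : Type*} [CommRing R] {L M : Type*} [AddCommGroup L] [Module R L] [AddCommGroup M]
  [Module R M]

/-- All series `∑ g ^ i f(i)` can be summed in `M`. -/
def HasSeries (g : R) (M : Type*) [AddCommGroup M] [Module R M] : Prop :=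
  ∃ S : (ℕ → M) → M, ∀ f, S f = f 0 + g • S fun i => f (i + 1)

/-- The only element of `M` divisible by all powers of `g` is zero. -/
def IsSep (g : R) (M : Type*) [AddCommGroup M] [Module R M] : Prop :=
  ∀ m : M, (∀ k : ℕ, ∃ m' : M, m = g ^ k • m') → m = 0

theorem HasSeries.prod {g : R} (hL : HasSeries g L) (hM : HasSeries g M) :
    HasSeries g (L × M) := by
  obtain ⟨S, hS⟩ := hL
  obtain ⟨T, hT⟩ := hM
  exact ⟨fun f => (S fun i => (f i).1, T fun i => (f i).2), fun f => Prod.ext (hS _) (hT _)⟩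

theorem HasSeries.pi {g : R} (hM : HasSeries g M) (ι : Type*) : HasSeries g (ι → M) := by
  obtain ⟨S, hS⟩ := hM
  exact ⟨fun f j => S fun i => f i j, fun f => funext fun j => hS _⟩

/-- Successive approximation: solve modulo g, divide the error by g, and sum the corrections. The
final error is divisible by every power of g. -/
theorem surjective_of_surjective_mod {g : R} (hL : HasSeries g L) (hM : IsSep g M) (Φ : L →ₗ[R] M)
    (h : ∀ m, ∃ x m', m = Φ x + g • m') : Function.Surjective Φ := by
  obtain ⟨S, hS⟩ := hL
  choose x m' hx using h
  intro m
  set μ : ℕ → M := fun k => m'^[k] m with hμ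
  have hstep : ∀ j, μ j - Φ (S fun i => x (μ (j + i)))
      = g • (μ (j + 1) - Φ (S fun i => x (μ (j + 1 + i)))) := by
    intro j
    have h1 : μ (j + 1) = m' (μ j) := Function.iterate_succ_apply' _ _ _
    rw [hS, map_add, map_smul, smul_sub, h1, add_zero]
    nth_rewrite 1 [hx (μ j)]
    simp only [add_assoc, add_comm 1]
    abel
  have hpow : ∀ k j, μ j - Φ (S fun i => x (μ (j + i)))
      = g ^ k • (μ (j + k) - Φ (S fun i => x (μ (j + k + i)))) := by
    intro k
    induction k with
    | zero => intro j; simp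
    | succ k ih => intro j; rw [ih j, hstep (j + k), smul_smul, ← pow_succ, add_assoc]
  refine ⟨S fun i => x (μ (0 + i)), (sub_eq_zero.1 (hM _ fun k => ⟨_, hpow k 0⟩)).symm⟩

/-- Exactness modulo g allows a relation to be divided by g: the contributions of ζ cancel by
commutativity and g is not a zero divisor on M. Iterating makes each coefficient infinitely
divisible. -/
theorem coeff_eq_zero_of_exact_mod {g : R} {ι : Type*} [Fintype ι] (hR : IsSep g R)
    (hM : ∀ m : M, g • m = 0 → m = 0) {δx δy : M →ₗ[R] M} (hcomm : ∀ m, δx (δy m) = δy (δx m))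
    (e : ι → M)
    (h : ∀ (c : ι → R) (ξ η m : M), ∑ i, c i • e i + δx ξ + δy η = g • m →
      (∀ i, ∃ c', c i = g * c') ∧ ∃ ζ ξ' η', ξ = δy ζ + g • ξ' ∧ η = -δx ζ + g • η')
    {c : ι → R} {ξ η : M} (h0 : ∑ i, c i • e i + δx ξ + δy η = 0) : c = 0 := by
  have key : ∀ (k : ℕ) (c : ι → R) (ξ η : M), ∑ i, c i • e i + δx ξ + δy η = 0 →
      ∀ i, ∃ c', c i = g ^ k * c' := by
    intro k
    induction k with
    | zero => exact fun c ξ η _ i => ⟨c i, by simp⟩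
    | succ k ih =>
      intro c ξ η h0
      obtain ⟨h1, ζ, ξ', η', rfl, rfl⟩ := h c ξ η 0 (by rw [h0, smul_zero])
      choose c' hc' using h1
      have h2 : ∑ i, c' i • e i + δx ξ' + δy η' = 0 := by
        refine hM _ ?_
        rw [← h0, smul_add, smul_add, Finset.smul_sum, map_add, map_add, map_neg, map_smul,
          map_smul, hcomm]
        simp only [hc', mul_smul]
        abel
      intro i
      obtain ⟨c'', hc''⟩ := ih c' ξ' η' h2 i
      exact ⟨c'', by rw [hc', hc'', pow_succ]; ring⟩
  funext i
  exact hR _ fun k => key k c ξ η h0 i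

end Lifting

/-! ### The reduction of `C₀` modulo `g` -/

section Reduction

variable {p : ℕ} [Fact p.Prime] {a n : ℕ} {g : ℂ_[p]}

/-- `g` as an element of `ℤ_q[g]`. -/
def gEl (a : ℕ) (g : ℂ_[p]) : ZqAdjoin p a g := ⟨g, self_mem_ZqAdjoin a g⟩

/-- The ring `ℤ_q[g] / (g)`. -/
abbrev ResRing (a : ℕ) (g : ℂ_[p]) : Type := ZqAdjoin p a g ⧸ Ideal.span {gEl a g}

/-- The reduction map `ℤ_q[g] → ℤ_q[g] / (g)`. -/
abbrev resMap (a : ℕ) (g : ℂ_[p]) : ZqAdjoin p a g →+* ResRing a g :=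
  Ideal.Quotient.mk (Ideal.span {gEl a g})

theorem resMap_eq_zero_iff {r : ZqAdjoin p a g} : resMap a g r = 0 ↔ ∃ r', r = gEl a g * r' := by
  rw [Ideal.Quotient.eq_zero_iff_mem, Ideal.mem_span_singleton]
  exact Iff.rfl

theorem IsUnif.resMap_eq_zero_iff_norm (hu : IsUnif p a g) {r : ZqAdjoin p a g} :
    resMap a g r = 0 ↔ ‖(r : ℂ_[p])‖ < 1 := by
  rw [resMap_eq_zero_iff]
  constructor
  · rintro ⟨r', rfl⟩
    change ‖g * (r' : ℂ_[p])‖ < 1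
    rw [norm_mul]
    exact (mul_le_of_le_one_right (norm_nonneg _) (hu.norm_le_one _ r'.2)).trans_lt hu.norm_lt_one
  · intro h
    obtain ⟨r', hr', e⟩ := hu.exists_eq_mul r r.2 h
    exact ⟨⟨r', hr'⟩, Subtype.ext e⟩

/-- The ideal (g) consists of the elements of norm less than 1, and the norm is multiplicative. -/
theorem IsUnif.isDomain_resRing (hu : IsUnif p a g) : IsDomain (ResRing a g) := by
  have : (Ideal.span {gEl a g}).IsPrime := by
    refine ⟨fun h => ?_, fun {x y} hxy => ?_⟩
    · have h1 : resMap a g 1 = 0 := Ideal.Quotient.eq_zero_iff_mem.2 (h ▸ Submodule.mem_top)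
      rw [hu.resMap_eq_zero_iff_norm] at h1
      simp at h1
    · rw [← Ideal.Quotient.eq_zero_iff_mem, hu.resMap_eq_zero_iff_norm] at hxy ⊢
      rw [← Ideal.Quotient.eq_zero_iff_mem, hu.resMap_eq_zero_iff_norm]
      by_contra! h
      have hx := le_antisymm (hu.norm_le_one x x.2) h.1
      have hy := le_antisymm (hu.norm_le_one y y.2) h.2
      simp [hx, hy] at hxy
  exact Ideal.Quotient.isDomain _

theorem IsUnif.isUnit_natCast_resRing (hu : IsUnif p a g) {m : ℕ} (hm : ¬ p ∣ m) :
    IsUnit (m : ResRing a g) := by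
  have hp : ((p : ℤ) : ResRing a g) = 0 := by
    have : resMap a g (p : ZqAdjoin p a g) = 0 :=
      hu.resMap_eq_zero_iff_norm.2 (by simpa using norm_p_lt_one)
    simpa using this
  have hco : IsCoprime (m : ℤ) (p : ℤ) :=
    Nat.isCoprime_iff_coprime.2
      (((Nat.Prime.coprime_iff_not_dvd (Fact.out : p.Prime)).2 hm).symm)
  obtain ⟨x, y, hxy⟩ := hco
  have h := congrArg (Int.cast : ℤ → ResRing a g) hxy
  push_cast at h hp
  rw [hp, mul_zero, add_zero] at h
  exact IsUnit.of_mul_eq_one_right _ h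

/-- The exponent in `x`, `y`, `z = 1 / (xy)` of the monomial with exponent `u`. -/
def expOf (u : ℤ × ℤ) : Fin 3 →₀ ℕ :=
  expo (u.1 + mMax u).toNat (u.2 + mMax u).toNat (mMax u).toNat

theorem natCast_expOf_zero (u : ℤ × ℤ) : (expOf u 0 : ℤ) = u.1 + mMax u := by
  rw [expOf, expo_zero, Int.toNat_of_nonneg]
  linarith [neg_fst_le_mMax u]

theorem natCast_expOf_one (u : ℤ × ℤ) : (expOf u 1 : ℤ) = u.2 + mMax u := by
  rw [expOf, expo_one, Int.toNat_of_nonneg]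
  linarith [neg_snd_le_mMax u]

theorem natCast_expOf_two (u : ℤ × ℤ) : (expOf u 2 : ℤ) = mMax u := by
  rw [expOf, expo_two, Int.toNat_of_nonneg (mMax_nonneg u)]

/-- Every lattice point is uniquely A(1,0) + j(0,1) + l(-1,-1) with A, j, l ≥ 0 not all positive;
the value of l is `mMax`. -/
theorem expOf_eq_iff (u : ℤ × ℤ) (d : Fin 3 →₀ ℕ) : expOf u = d ↔
    (u.1 = d 0 - d 2 ∧ u.2 = d 1 - d 2) ∧ (d 0 = 0 ∨ d 1 = 0 ∨ d 2 = 0) := by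
  have h0 := natCast_expOf_zero u
  have h1 := natCast_expOf_one u
  have h2 := natCast_expOf_two u
  have hm : mMax u = max 0 (max (-u.1) (-u.2)) := rfl
  constructor
  · rintro rfl
    omega
  · rintro ⟨⟨h3, h4⟩, h5⟩
    refine finsupp_fin_three_ext ?_ ?_ ?_ <;> omega

theorem expOf_injective : Function.Injective expOf := by
  intro u v h
  have hu := ((expOf_eq_iff u _).1 rfl).1
  have hv := ((expOf_eq_iff v _).1 rfl).1
  rw [h, ← hv.1, ← hv.2] at hu
  exact Prod.ext hu.1 hu.2

theorem expOf_eq_zero (u : ℤ × ℤ) : expOf u 0 = 0 ∨ expOf u 1 = 0 ∨ expOf u 2 = 0 :=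
  ((expOf_eq_iff u _).1 rfl).2

theorem natCast_wt_eq_expOf (n : ℕ) (u : ℤ × ℤ) :
    wt n u = expOf u 0 + n * (expOf u 1 + expOf u 2) := by
  zify
  rw [intCast_wt, natCast_expOf_zero, natCast_expOf_one, natCast_expOf_two]

open MvPolynomial

/-- The polynomial `q` represents the reduction of `c` modulo `g`. -/
def Reduces (a n : ℕ) (g : ℂ_[p]) (c : ℤ × ℤ → ℂ_[p]) (q : MvPolynomial (Fin 3) (ResRing a g)) :
    Prop :=
  ∀ u, ∃ r : ZqAdjoin p a g, c u = r * g ^ wt n u ∧ resMap a g r = coeff (expOf u) q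

variable {c c' : ℤ × ℤ → ℂ_[p]} {q q' : MvPolynomial (Fin 3) (ResRing a g)}

theorem Reduces.add (h : Reduces a n g c q) (h' : Reduces a n g c' q') :
    Reduces a n g (c + c') (q + q') := by
  intro u
  obtain ⟨r, hr, e⟩ := h u
  obtain ⟨r', hr', e'⟩ := h' u
  refine ⟨r + r', ?_, by rw [map_add, e, e', coeff_add]⟩
  rw [Pi.add_apply, hr, hr', Subring.coe_add]
  ring

theorem Reduces.smul (h : Reduces a n g c q) (s : ZqAdjoin p a g) :
    Reduces a n g (s • c) (C (resMap a g s) * q) := by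
  intro u
  obtain ⟨r, hr, e⟩ := h u
  refine ⟨s * r, ?_, by rw [map_mul, e, coeff_C_mul]⟩
  rw [Pi.smul_apply, hr, Subring.smul_def, smul_eq_mul, Subring.coe_mul]
  ring

theorem Reduces.sum {ι : Type*} (t : Finset ι) {c : ι → ℤ × ℤ → ℂ_[p]}
    {q : ι → MvPolynomial (Fin 3) (ResRing a g)} (h : ∀ i, Reduces a n g (c i) (q i)) :
    Reduces a n g (∑ i ∈ t, c i) (∑ i ∈ t, q i) := by
  classical
  induction t using Finset.induction_on with
  | empty => exact fun u => ⟨0, by simp, by simp⟩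
  | insert i t hi ih =>
    rw [Finset.sum_insert hi, Finset.sum_insert hi]
    exact (h i).add ih

theorem reduces_gEl_smul (d : C0 p a n g) :
    Reduces a n g ((gEl a g • d : C0 p a n g) : ℤ × ℤ → ℂ_[p]) 0 := by
  obtain ⟨ξ, -, hξ⟩ := d.2
  intro u
  refine ⟨gEl a g * ξ u, ?_, ?_⟩
  · change g * (d : ℤ × ℤ → ℂ_[p]) u = g * (ξ u : ℂ_[p]) * _
    rw [hξ, mul_assoc]
  · rw [coeff_zero, resMap_eq_zero_iff]
    exact ⟨_, rfl⟩

theorem Reduces.congr (h : Reduces a n g c q) (hq : xyz (ResRing a g) ∣ q - q') :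
    Reduces a n g c q' := by
  intro u
  obtain ⟨r, hr, e⟩ := h u
  refine ⟨r, hr, e.trans ?_⟩
  have := (xyz_dvd_iff _).1 hq (expOf u) (expOf_eq_zero u)
  rwa [coeff_sub, sub_eq_zero] at this

theorem Reduces.dvd_sub (hu : IsUnif p a g) (h : Reduces a n g c q) (h' : Reduces a n g c q') :
    xyz (ResRing a g) ∣ q - q' := by
  refine (xyz_dvd_iff _).2 fun d hd => ?_
  obtain ⟨u, rfl⟩ : ∃ u, expOf u = d :=
    ⟨((d 0 : ℤ) - d 2, (d 1 : ℤ) - d 2), (expOf_eq_iff _ _).2 ⟨⟨rfl, rfl⟩, hd⟩⟩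
  obtain ⟨r, hr, e⟩ := h u
  obtain ⟨r', hr', e'⟩ := h' u
  have : r = r' := by
    refine Subtype.ext (mul_right_cancel₀ (pow_ne_zero (wt n u) hu.ne_zero) ?_)
    rw [← hr, hr']
  rw [coeff_sub, ← e, ← e', this, sub_self]

/-- Coefficients tend to 0, so only finitely many survive modulo g. -/
theorem exists_reduces (hu : IsUnif p a g) (hn : 0 < n) (c : C0 p a n g) :
    ∃ q, Reduces a n g (c : ℤ × ℤ → ℂ_[p]) q := by
  obtain ⟨ξ, hlim, hξ⟩ := c.2
  rw [comap_omega_atTop hn] at hlim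
  have hfin : {u | ¬ ‖(ξ u : ℂ_[p])‖ < 1}.Finite :=
    hlim.eventually (eventually_lt_nhds (one_pos))
  classical
  refine ⟨∑ u ∈ hfin.toFinset, monomial (expOf u) (resMap a g (ξ u)), fun u => ⟨ξ u, hξ u, ?_⟩⟩
  rw [coeff_sum]
  simp only [coeff_monomial, expOf_injective.eq_iff]
  rw [Finset.sum_ite_eq']
  split_ifs with h
  · rfl
  · rw [Set.Finite.mem_toFinset, Set.mem_ofPred_eq, not_not] at h
    exact hu.resMap_eq_zero_iff_norm.2 h

theorem exists_reduces_of_polynomial (hn : 0 < n)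
    (q : MvPolynomial (Fin 3) (ResRing a g)) :
    ∃ c : C0 p a n g, Reduces a n g (c : ℤ × ℤ → ℂ_[p]) q := by
  -- Zero is lifted to zero so that the lifted series has finite support.
  have hlift : ∀ x : ResRing a g, ∃ r : ZqAdjoin p a g, resMap a g r = x ∧ (x = 0 → r = 0) := by
    intro x
    by_cases hx : x = 0
    · exact ⟨0, by rw [map_zero, hx], fun _ => rfl⟩
    · obtain ⟨r, hr⟩ := Ideal.Quotient.mk_surjective x
      exact ⟨r, hr, fun h => absurd h hx⟩
  choose r hr hr0 using hlift
  refine ⟨⟨fun u => r (coeff (expOf u) q) * g ^ wt n u, fun u => r (coeff (expOf u) q), ?_,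
    fun u => rfl⟩, fun u => ⟨r (coeff (expOf u) q), rfl, hr _⟩⟩
  rw [comap_omega_atTop hn]
  refine tendsto_const_nhds.congr' ?_
  have hfin : {u | expOf u ∈ q.support}.Finite :=
    q.support.finite_toSet.preimage expOf_injective.injOn
  refine hfin.subset fun u hu' => ?_
  by_contra h
  refine hu' ?_
  change (0 : ℝ) = ‖(r (coeff (expOf u) q) : ℂ_[p])‖
  rw [hr0 _ (notMem_support_iff.1 h)]
  simp

theorem exists_eq_gEl_smul (hu : IsUnif p a g) (hn : 0 < n) {c : C0 p a n g}
    (h : Reduces a n g (c : ℤ × ℤ → ℂ_[p]) 0) : ∃ d : C0 p a n g, c = gEl a g • d := by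
  have hc := (mem_C0_iff hu hn _).1 c.2
  refine ⟨⟨fun u => g⁻¹ * (c : ℤ × ℤ → ℂ_[p]) u, (mem_C0_iff hu hn _).2 ⟨fun u => ?_, ?_⟩⟩, ?_⟩
  · obtain ⟨r, hr, e⟩ := h u
    rw [coeff_zero, resMap_eq_zero_iff] at e
    obtain ⟨r', rfl⟩ := e
    have : g⁻¹ * (c : ℤ × ℤ → ℂ_[p]) u / g ^ wt n u = r' := by
      rw [hr, ← mul_assoc, mul_div_cancel_right₀ _ (pow_ne_zero _ hu.ne_zero)]
      exact inv_mul_cancel_left₀ hu.ne_zero _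
    rw [this]
    exact r'.2
  · simp only [mul_div_assoc]
    simpa using hc.2.const_mul g⁻¹
  · ext u
    exact (mul_inv_cancel_left₀ hu.ne_zero _).symm

/-! #### Reduction of the operators -/

theorem Reduces.diag {f : ℤ × ℤ → ℤ} (h : Reduces a n g c q)
    (hq : ∀ u, coeff (expOf u) q' = (f u : ResRing a g) * coeff (expOf u) q) :
    Reduces a n g (fun u => (f u : ℂ_[p]) * c u) q' := by
  intro u
  obtain ⟨r, hr, e⟩ := h u
  refine ⟨f u * r, ?_, by rw [map_mul, e, hq, map_intCast]⟩
  simp only [hr, Subring.coe_mul, Subring.coe_intCast]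
  ring

theorem Reduces.fst_mul (h : Reduces a n g c q) :
    Reduces a n g (fun u => (u.1 : ℂ_[p]) * c u) (logDerX (ResRing a g) q) := by
  refine h.diag fun u => ?_
  rw [coeff_logDerX, ((expOf_eq_iff u _).1 rfl).1.1]
  push_cast
  rfl

theorem Reduces.snd_mul (h : Reduces a n g c q) :
    Reduces a n g (fun u => (u.2 : ℂ_[p]) * c u) (logDerY (ResRing a g) q) := by
  refine h.diag fun u => ?_
  rw [coeff_logDerY, ((expOf_eq_iff u _).1 rfl).1.2]
  push_cast
  rfl

/-- Multiplication by a vertex monomial of the triangle. -/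
theorem Reduces.shift (h : Reduces a n g c q) {v : ℤ × ℤ} {e : Fin 3 →₀ ℕ}
    (hpos : ∀ u, e ≤ expOf u → expOf (u - v) = expOf u - e ∧ wt n (u - v) + n = wt n u)
    (hneg : ∀ u, ¬ e ≤ expOf u → wt n u < wt n (u - v) + n) (s : ZqAdjoin p a g) :
    Reduces a n g (fun u => (s : ℂ_[p]) * g ^ n * c (u - v))
      (monomial e (resMap a g s) * q) := by
  intro u
  obtain ⟨r, hr, er⟩ := h (u - v)
  rw [coeff_monomial_mul']
  split_ifs with hu
  · obtain ⟨h1, h2⟩ := hpos u hu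
    refine ⟨s * r, ?_, by rw [map_mul, er, h1]⟩
    simp only [hr, Subring.coe_mul]
    rw [← h2, pow_add]
    ring
  -- Here u - v and v share no cone, so the weights add up to strictly more than that of u and the
  -- term is a multiple of g.
  · obtain ⟨d, hd⟩ := Nat.exists_eq_add_of_lt (hneg u hu)
    refine ⟨gEl a g * (gEl a g ^ d * s * r), ?_, resMap_eq_zero_iff.2 ⟨_, rfl⟩⟩
    simp only [hr, Subring.coe_mul, Subring.coe_pow]
    change _ = g * (g ^ d * s * r) * g ^ wt n u
    have : g ^ wt n (u - v) * g ^ n = g ^ wt n u * g ^ d * g := by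
      rw [← pow_add, hd, pow_succ, pow_add]
    linear_combination ((s : ℂ_[p]) * r) * this

theorem Reduces.shift_x (h : Reduces a n g c q) (s : ZqAdjoin p a g) :
    Reduces a n g (fun u => (s : ℂ_[p]) * g ^ n * c (u - ((n : ℤ), 0)))
      (monomial (Finsupp.single 0 n) (resMap a g s) * q) := by
  refine h.shift (fun u hu => ?_) (fun u hu => ?_) s <;> rw [Finsupp.single_le_iff] at hu
  · have h1 := (expOf_eq_iff u _).1 rfl
    have h2 : expOf (u - ((n : ℤ), 0)) = expOf u - Finsupp.single 0 n := by
      rw [expOf_eq_iff]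
      simp [Finsupp.tsub_apply]
      omega
    refine ⟨h2, ?_⟩
    rw [natCast_wt_eq_expOf, natCast_wt_eq_expOf, h2]
    simp [Finsupp.tsub_apply]
    omega
  · have h0 := natCast_expOf_zero u
    have h1 := neg_fst_le_mMax (u - ((n : ℤ), 0))
    have h2 : mMax u + 1 ≤ mMax (u - ((n : ℤ), 0)) := by
      rw [Prod.fst_sub] at h1
      omega
    zify
    rw [intCast_wt, intCast_wt, Prod.fst_sub, Prod.snd_sub]
    nlinarith [mul_le_mul_of_nonneg_left h2 (Int.natCast_nonneg n)]

theorem Reduces.shift_y (h : Reduces a n g c q) (s : ZqAdjoin p a g) :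
    Reduces a n g (fun u => (s : ℂ_[p]) * g ^ n * c (u - (0, 1)))
      (monomial (Finsupp.single 1 1) (resMap a g s) * q) := by
  refine h.shift (fun u hu => ?_) (fun u hu => ?_) s <;> rw [Finsupp.single_le_iff] at hu
  · have h1 := (expOf_eq_iff u _).1 rfl
    have h2 : expOf (u - (0, 1)) = expOf u - Finsupp.single 1 1 := by
      rw [expOf_eq_iff]
      simp [Finsupp.tsub_apply]
      omega
    refine ⟨h2, ?_⟩
    rw [natCast_wt_eq_expOf, natCast_wt_eq_expOf, h2]
    obtain ⟨k, hk⟩ := Nat.exists_eq_add_of_le' hu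
    simp [Finsupp.tsub_apply, hk]
    ring
  · have h0 := natCast_expOf_one u
    have h1 := neg_snd_le_mMax (u - (0, 1))
    have h2 : mMax u + 1 ≤ mMax (u - (0, 1)) := by
      rw [Prod.snd_sub] at h1
      simp only at h1
      omega
    zify
    rw [intCast_wt, intCast_wt, Prod.fst_sub, Prod.snd_sub]
    nlinarith [mul_le_mul_of_nonneg_left h2 (Int.natCast_nonneg n)]

theorem Reduces.shift_z (h : Reduces a n g c q) (s : ZqAdjoin p a g) :
    Reduces a n g (fun u => (s : ℂ_[p]) * g ^ n * c (u - (-1, -1)))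
      (monomial (Finsupp.single 2 1) (resMap a g s) * q) := by
  refine h.shift (fun u hu => ?_) (fun u hu => ?_) s <;> rw [Finsupp.single_le_iff] at hu
  · have h1 := (expOf_eq_iff u _).1 rfl
    have h2 : expOf (u - (-1, -1)) = expOf u - Finsupp.single 2 1 := by
      rw [expOf_eq_iff]
      simp [Finsupp.tsub_apply]
      omega
    refine ⟨h2, ?_⟩
    rw [natCast_wt_eq_expOf, natCast_wt_eq_expOf, h2]
    obtain ⟨k, hk⟩ := Nat.exists_eq_add_of_le' hu
    simp [Finsupp.tsub_apply, hk]
    ring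
  · have h0 := natCast_expOf_two u
    have h1 := mMax_nonneg (u - (-1, -1))
    have h2 : mMax u = 0 := by omega
    zify
    rw [intCast_wt, intCast_wt, Prod.fst_sub, Prod.snd_sub, h2]
    nlinarith [mul_nonneg (Int.natCast_nonneg n) h1]

end Reduction

/-! ### Completeness of `C₀` -/

section Complete

variable {p : ℕ} [Fact p.Prime] {a n : ℕ} {g : ℂ_[p]}

theorem summable_pow_mul (hu : IsUnif p a g) {f : ℕ → ℂ_[p]} (hf : ∀ i, ‖f i‖ ≤ 1) :
    Summable fun i => g ^ i * f i := by
  refine Summable.of_norm_bounded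
    (summable_geometric_of_lt_one (norm_nonneg g) hu.norm_lt_one) fun i => ?_
  rw [norm_mul, norm_pow]
  exact mul_le_of_le_one_right (by positivity) (hf i)

theorem tsum_pow_mul_eq (hu : IsUnif p a g) {f : ℕ → ℂ_[p]} (hf : ∀ i, ‖f i‖ ≤ 1) :
    ∑' i, g ^ i * f i = f 0 + g * ∑' i, g ^ i * f (i + 1) := by
  rw [(summable_pow_mul hu hf).tsum_eq_zero_add, pow_zero, one_mul, ← tsum_mul_left]
  congr 1
  exact tsum_congr fun i => by ring

theorem hasSeries_ZqAdjoin (hu : IsUnif p a g) : HasSeries (gEl a g) (ZqAdjoin p a g) := by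
  refine ⟨fun f => ⟨∑' i, g ^ i * (f i : ℂ_[p]), tsum_mem_of_isClosed hu.isClosed fun i =>
    mul_mem (pow_mem (self_mem_ZqAdjoin a g) i) (f i).2⟩, fun f => Subtype.ext ?_⟩
  exact tsum_pow_mul_eq hu fun i => hu.norm_le_one _ (f i).2

theorem hasSeries_C0 (hu : IsUnif p a g) (hn : 0 < n) : HasSeries (gEl a g) (C0 p a n g) := by
  have hmem : ∀ f : ℕ → C0 p a n g,
      (fun u => ∑' i, g ^ i * (f i : ℤ × ℤ → ℂ_[p]) u) ∈ C0 p a n g := by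
    intro f
    have hf := fun i => (mem_C0_iff hu hn _).1 (f i).2
    rw [mem_C0_iff hu hn]
    simp only [← tsum_div_const, mul_div_assoc]
    refine ⟨fun u => tsum_mem_of_isClosed hu.isClosed fun i =>
      mul_mem (pow_mem (self_mem_ZqAdjoin a g) i) ((hf i).1 u), ?_⟩
    have hlim := tendsto_tsum_of_dominated_convergence (𝓕 := (cofinite : Filter (ℤ × ℤ)))
      (f := fun u i => g ^ i * ((f i : ℤ × ℤ → ℂ_[p]) u / g ^ wt n u))
      (g := fun _ => (0 : ℂ_[p])) (bound := fun i => ‖g‖ ^ i)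
      (summable_geometric_of_lt_one (norm_nonneg _) hu.norm_lt_one)
      (fun i => by simpa using (hf i).2.const_mul (g ^ i))
      (Eventually.of_forall fun u i => by
        rw [norm_mul, norm_pow]
        exact mul_le_of_le_one_right (by positivity) (hu.norm_le_one _ ((hf i).1 u)))
    simpa using hlim
  refine ⟨fun f => ⟨_, hmem f⟩, fun f => ?_⟩
  ext u
  exact tsum_pow_mul_eq hu fun i => norm_le_one_of_mem_C0 hu (f i).2 u

theorem eq_zero_of_norm_le_pow (hu : IsUnif p a g) {x : ℂ_[p]} (h : ∀ k : ℕ, ‖x‖ ≤ ‖g‖ ^ k) :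
    x = 0 :=
  norm_le_zero_iff.1 (ge_of_tendsto'
    (tendsto_pow_atTop_nhds_zero_of_lt_one (norm_nonneg _) hu.norm_lt_one) h)

theorem isSep_ZqAdjoin (hu : IsUnif p a g) : IsSep (gEl a g) (ZqAdjoin p a g) := by
  intro r h
  refine Subtype.ext (eq_zero_of_norm_le_pow hu fun k => ?_)
  obtain ⟨r', rfl⟩ := h k
  change ‖g ^ k * (r' : ℂ_[p])‖ ≤ _
  rw [norm_mul, norm_pow]
  exact mul_le_of_le_one_right (by positivity) (hu.norm_le_one _ r'.2)

theorem isSep_C0 (hu : IsUnif p a g) : IsSep (gEl a g) (C0 p a n g) := by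
  intro m h
  ext u
  refine eq_zero_of_norm_le_pow hu fun k => ?_
  obtain ⟨m', rfl⟩ := h k
  change ‖g ^ k * (m' : ℤ × ℤ → ℂ_[p]) u‖ ≤ _
  rw [norm_mul, norm_pow]
  exact mul_le_of_le_one_right (by positivity) (norm_le_one_of_mem_C0 hu m'.2 u)

theorem eq_zero_of_gEl_smul_eq_zero (hu : IsUnif p a g) {m : C0 p a n g}
    (h : gEl a g • m = 0) : m = 0 := by
  ext u
  have h1 : g * (m : ℤ × ℤ → ℂ_[p]) u = 0 :=
    congrFun (congrArg (Subtype.val : C0 p a n g → ℤ × ℤ → ℂ_[p]) h) u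
  exact (mul_eq_zero.1 h1).resolve_left hu.ne_zero

end Complete

/-! ### The operators `D_x` and `D_y` on `C₀` -/

section Differential

variable {p : ℕ} [Fact p.Prime] {a n : ℕ} {g : ℂ_[p]}

variable (p a n g) in
/-- The data defining `D_x` and `D_y`: coefficients `b(i)` in `g^i γ^{p^i} ℤ_q[g]` with leading one
`γ = g^n`, and an element `s` of `ℤ_q[g]`. -/
structure OpData (b : ℕ → ℂ_[p]) (s : ℂ_[p]) : Prop where
  isUnif : IsUnif p a g
  n_pos : 0 < n
  mem : s ∈ ZqAdjoin p a g
  zero : b 0 = g ^ n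
  exists_eq : ∀ i, ∃ r ∈ ZqAdjoin p a g, b i = r * g ^ i * g ^ (n * p ^ i)

variable {b : ℕ → ℂ_[p]} {s : ℂ_[p]}

theorem OpData.isAdm_x (h : OpData p a n g b s) :
    IsAdm p a n g (fun i => (n : ℂ_[p]) * b i) (fun i => ((n * p ^ i : ℤ), (0 : ℤ))) := by
  refine IsAdm.mul_left (fun i => ?_) fun i => natCast_mem _ n
  have : wt n ((n * p ^ i : ℤ), (0 : ℤ)) = n * p ^ i := by
    exact_mod_cast wt_natCast_zero n (n * p ^ i)
  rw [this]
  exact h.exists_eq i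

theorem OpData.isAdm_y (h : OpData p a n g b s) :
    IsAdm p a n g b (fun i => ((0 : ℤ), (p ^ i : ℤ))) := by
  intro i
  have : wt n ((0 : ℤ), (p ^ i : ℤ)) = n * p ^ i := by
    exact_mod_cast wt_zero_natCast n (p ^ i)
  rw [this]
  exact h.exists_eq i

theorem OpData.isAdm_z (h : OpData p a n g b s) :
    IsAdm p a n g (fun i => -s ^ p ^ i * b i) (fun i => (-(p ^ i : ℤ), -(p ^ i : ℤ))) := by
  refine IsAdm.mul_left (fun i => ?_) fun i => neg_mem (pow_mem h.mem _)
  have : wt n (-(p ^ i : ℤ), -(p ^ i : ℤ)) = n * p ^ i := by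
    exact_mod_cast wt_neg_natCast n (p ^ i)
  rw [this]
  exact h.exists_eq i

/-- `D_x` on `C₀`. -/
def OpData.opX (h : OpData p a n g b s) : Module.End (ZqAdjoin p a g) (C0 p a n g) :=
  diagLin h.isUnif h.n_pos (AddMonoidHom.fst ℤ ℤ) + shiftLin h.isUnif h.n_pos h.isAdm_x
    + shiftLin h.isUnif h.n_pos h.isAdm_z

/-- `D_y` on `C₀`. -/
def OpData.opY (h : OpData p a n g b s) : Module.End (ZqAdjoin p a g) (C0 p a n g) :=
  diagLin h.isUnif h.n_pos (AddMonoidHom.snd ℤ ℤ) + shiftLin h.isUnif h.n_pos h.isAdm_y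
    + shiftLin h.isUnif h.n_pos h.isAdm_z

theorem OpData.opX_apply (h : OpData p a n g b s) (c : C0 p a n g) (u : ℤ × ℤ) :
    (h.opX c : ℤ × ℤ → ℂ_[p]) u = (u.1 : ℂ_[p]) * (c : ℤ × ℤ → ℂ_[p]) u
      + ∑' i : ℕ, b i * ((n : ℂ_[p]) * (c : ℤ × ℤ → ℂ_[p]) (u - ((n * p ^ i : ℤ), (0 : ℤ)))
        - s ^ p ^ i * (c : ℤ × ℤ → ℂ_[p]) (u - (-(p ^ i : ℤ), -(p ^ i : ℤ)))) := by
  have hc := norm_le_one_of_mem_C0 h.isUnif c.2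
  change (u.1 : ℂ_[p]) * (c : ℤ × ℤ → ℂ_[p]) u + ∑' i, _ + ∑' i, _ = _
  rw [add_assoc, ← Summable.tsum_add (summable_shift (h.isAdm_x.summable_norm h.isUnif) _ hc u)
    (summable_shift (h.isAdm_z.summable_norm h.isUnif) _ hc u)]
  congr 1
  exact tsum_congr fun i => by ring

theorem OpData.opY_apply (h : OpData p a n g b s) (c : C0 p a n g) (u : ℤ × ℤ) :
    (h.opY c : ℤ × ℤ → ℂ_[p]) u = (u.2 : ℂ_[p]) * (c : ℤ × ℤ → ℂ_[p]) u
      + ∑' i : ℕ, b i * ((c : ℤ × ℤ → ℂ_[p]) (u - ((0 : ℤ), (p ^ i : ℤ)))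
        - s ^ p ^ i * (c : ℤ × ℤ → ℂ_[p]) (u - (-(p ^ i : ℤ), -(p ^ i : ℤ)))) := by
  have hc := norm_le_one_of_mem_C0 h.isUnif c.2
  change (u.2 : ℂ_[p]) * (c : ℤ × ℤ → ℂ_[p]) u + ∑' i, _ + ∑' i, _ = _
  rw [add_assoc, ← Summable.tsum_add (summable_shift (h.isAdm_y.summable_norm h.isUnif) _ hc u)
    (summable_shift (h.isAdm_z.summable_norm h.isUnif) _ hc u)]
  congr 1
  exact tsum_congr fun i => by ring

/-- The x-series commutes with y∂/∂y and the y-series with x∂/∂x. The exponents (-p^i, -p^i) have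
equal coordinates, so the two commutators with the z-series agree and cancel. -/
theorem OpData.opX_mul_opY (h : OpData p a n g b s) : h.opX * h.opY = h.opY * h.opX := by
  have hcomm : ∀ (f : ℤ × ℤ →+ ℤ) {b' : ℕ → ℂ_[p]} {v : ℕ → ℤ × ℤ} (hb : IsAdm p a n g b' v),
      (∀ i, f (v i) = 0) → diagLin h.isUnif h.n_pos f * shiftLin h.isUnif h.n_pos hb
        = shiftLin h.isUnif h.n_pos hb * diagLin h.isUnif h.n_pos f := by
    intro f b' v hb h0
    have h1 : shiftLin h.isUnif h.n_pos (hb.mul_left (r := fun i => (f (v i) : ℂ_[p]))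
        fun _ => intCast_mem _ _) = 0 := by
      ext c u
      rw [shiftLin_apply]
      simp [h0]
    rw [diagLin_mul_shiftLin, h1, add_zero]
  have h1 := hcomm (AddMonoidHom.fst ℤ ℤ) h.isAdm_y fun _ => rfl
  have h2 := hcomm (AddMonoidHom.snd ℤ ℤ) h.isAdm_x fun _ => rfl
  have h3 := diagLin_mul_shiftLin h.isUnif h.n_pos (AddMonoidHom.fst ℤ ℤ) h.isAdm_z
  have h4 := diagLin_mul_shiftLin h.isUnif h.n_pos (AddMonoidHom.snd ℤ ℤ) h.isAdm_z
  simp only [AddMonoidHom.coe_fst, AddMonoidHom.coe_snd] at h1 h2 h3 h4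
  have h5 := diagLin_comm (n := n) h.isUnif h.n_pos (Prod.fst : ℤ × ℤ → ℤ) Prod.snd
  have h6 := shiftLin_comm h.isUnif h.n_pos h.isAdm_x h.isAdm_y
  have h7 := shiftLin_comm h.isUnif h.n_pos h.isAdm_x h.isAdm_z
  have h8 := shiftLin_comm h.isUnif h.n_pos h.isAdm_y h.isAdm_z
  simp only [OpData.opX, OpData.opY, AddMonoidHom.coe_fst, AddMonoidHom.coe_snd, add_mul, mul_add,
    h1, h2, h3, h4, h5, h6, h7, h8]
  abel

open MvPolynomial

/-- The terms with i = 0 give the symbol; `exists_shiftLin_eq` makes the others a multiple of g. -/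
theorem OpData.reduces_opX (h : OpData p a n g b s) {c : C0 p a n g}
    {q : MvPolynomial (Fin 3) (ResRing a g)} (hq : Reduces a n g (c : ℤ × ℤ → ℂ_[p]) q) :
    Reduces a n g (h.opX c : ℤ × ℤ → ℂ_[p]) (redDx n (resMap a g ⟨s, h.mem⟩) q) := by
  obtain ⟨d, hd⟩ := exists_shiftLin_eq h.isUnif h.n_pos h.isAdm_x c
  obtain ⟨d', hd'⟩ := exists_shiftLin_eq h.isUnif h.n_pos h.isAdm_z c
  have h1 := (((hq.fst_mul.add (hq.shift_x (n : ZqAdjoin p a g))).add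
    (hq.shift_z (-⟨s, h.mem⟩))).add (reduces_gEl_smul d)).add (reduces_gEl_smul d')
  have e1 : redDx n (resMap a g ⟨s, h.mem⟩) q = logDerX (ResRing a g) q
      + monomial (Finsupp.single 0 n) (resMap a g (n : ZqAdjoin p a g)) * q
      + monomial (Finsupp.single 2 1) (resMap a g (-⟨s, h.mem⟩)) * q + 0 + 0 := by
    rw [redDx_apply, symbX, (resMap a g).map_neg, map_neg, map_natCast (resMap a g)]
    ring
  rw [e1]
  convert h1 using 1
  funext u
  change (u.1 : ℂ_[p]) * (c : ℤ × ℤ → ℂ_[p]) u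
    + (shiftLin h.isUnif h.n_pos h.isAdm_x c : ℤ × ℤ → ℂ_[p]) u
    + (shiftLin h.isUnif h.n_pos h.isAdm_z c : ℤ × ℤ → ℂ_[p]) u
    = (u.1 : ℂ_[p]) * (c : ℤ × ℤ → ℂ_[p]) u
      + ((n : ZqAdjoin p a g) : ℂ_[p]) * g ^ n * (c : ℤ × ℤ → ℂ_[p]) (u - ((n : ℤ), 0))
      + (-s) * g ^ n * (c : ℤ × ℤ → ℂ_[p]) (u - (-1, -1))
      + g * (d : ℤ × ℤ → ℂ_[p]) u + g * (d' : ℤ × ℤ → ℂ_[p]) u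
  rw [hd, hd', h.zero]
  simp only [pow_zero, mul_one, pow_one, Subring.coe_natCast]
  ring

theorem OpData.reduces_opY (h : OpData p a n g b s) {c : C0 p a n g}
    {q : MvPolynomial (Fin 3) (ResRing a g)} (hq : Reduces a n g (c : ℤ × ℤ → ℂ_[p]) q) :
    Reduces a n g (h.opY c : ℤ × ℤ → ℂ_[p]) (redDy (resMap a g ⟨s, h.mem⟩) q) := by
  obtain ⟨d, hd⟩ := exists_shiftLin_eq h.isUnif h.n_pos h.isAdm_y c
  obtain ⟨d', hd'⟩ := exists_shiftLin_eq h.isUnif h.n_pos h.isAdm_z c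
  have h1 := (((hq.snd_mul.add (hq.shift_y 1)).add
    (hq.shift_z (-⟨s, h.mem⟩))).add (reduces_gEl_smul d)).add (reduces_gEl_smul d')
  have e1 : redDy (resMap a g ⟨s, h.mem⟩) q = logDerY (ResRing a g) q
      + monomial (Finsupp.single 1 1) (resMap a g 1) * q
      + monomial (Finsupp.single 2 1) (resMap a g (-⟨s, h.mem⟩)) * q + 0 + 0 := by
    rw [redDy_apply, symbY, (resMap a g).map_neg, map_neg, map_one (resMap a g)]
    ring
  rw [e1]
  convert h1 using 1
  funext u
  change (u.2 : ℂ_[p]) * (c : ℤ × ℤ → ℂ_[p]) u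
    + (shiftLin h.isUnif h.n_pos h.isAdm_y c : ℤ × ℤ → ℂ_[p]) u
    + (shiftLin h.isUnif h.n_pos h.isAdm_z c : ℤ × ℤ → ℂ_[p]) u
    = (u.2 : ℂ_[p]) * (c : ℤ × ℤ → ℂ_[p]) u
      + ((1 : ZqAdjoin p a g) : ℂ_[p]) * g ^ n * (c : ℤ × ℤ → ℂ_[p]) (u - (0, 1))
      + (-s) * g ^ n * (c : ℤ × ℤ → ℂ_[p]) (u - (-1, -1))
      + g * (d : ℤ × ℤ → ℂ_[p]) u + g * (d' : ℤ × ℤ → ℂ_[p]) u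
  rw [hd, hd', h.zero]
  simp only [pow_zero, pow_one, Subring.coe_one]
  ring

/-! ### Basis monomials and the lift from the reduction to C₀ -/

theorem expOf_epsExp (n i : ℕ) : expOf (epsExp n i) = basisExpo n i := by
  rw [expOf_eq_iff, epsExp, basisExpo]
  split_ifs <;> simp
  omega

theorem reduces_epsTilde (i : Fin (2 * n + 1)) :
    Reduces a n g (epsTilde p a n g i : ℤ × ℤ → ℂ_[p]) (monomial (basisExpo n i) 1) := by
  classical
  intro u
  rw [← expOf_epsExp, coeff_monomial]
  by_cases h : epsExp n i = u
  · refine ⟨1, ?_, by rw [if_pos (by rw [h]), map_one]⟩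
    simp [epsTilde, h]
  · refine ⟨0, ?_, by rw [if_neg fun e => h (expOf_injective e), map_zero]⟩
    simp [epsTilde, Pi.single_eq_of_ne (Ne.symm h)]

theorem reduces_sum_epsTilde (r : Fin (2 * n + 1) → ZqAdjoin p a g) :
    Reduces a n g ((∑ i, r i • epsTilde p a n g i : C0 p a n g) : ℤ × ℤ → ℂ_[p])
      (basisComb n fun i => resMap a g (r i)) := by
  have h := Reduces.sum Finset.univ fun i : Fin (2 * n + 1) =>
    (reduces_epsTilde (p := p) (a := a) (g := g) i).smul (r i)
  convert h using 1
  · simp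
  · refine Finset.sum_congr rfl fun i _ => ?_
    rw [C_mul_monomial, mul_one]

/-- The operator `(r, ξ, η) ↦ ∑ r(i) ε̃(i) + D_x ξ + D_y η`. -/
def OpData.total (h : OpData p a n g b s) :
    (Fin (2 * n + 1) → ZqAdjoin p a g) × C0 p a n g × C0 p a n g →ₗ[ZqAdjoin p a g] C0 p a n g :=
  (Fintype.linearCombination (ZqAdjoin p a g) (epsTilde p a n g)).coprod (h.opX.coprod h.opY)

theorem OpData.total_apply (h : OpData p a n g b s) (r : Fin (2 * n + 1) → ZqAdjoin p a g)
    (ξ η : C0 p a n g) :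
    h.total (r, ξ, η) = ∑ i, r i • epsTilde p a n g i + h.opX ξ + h.opY η := by
  simp [OpData.total, Fintype.linearCombination_apply, add_assoc]

theorem OpData.reduces_total (h : OpData p a n g b s) {r : Fin (2 * n + 1) → ZqAdjoin p a g}
    {ξ η : C0 p a n g} {qξ qη : MvPolynomial (Fin 3) (ResRing a g)}
    (hξ : Reduces a n g (ξ : ℤ × ℤ → ℂ_[p]) qξ) (hη : Reduces a n g (η : ℤ × ℤ → ℂ_[p]) qη) :
    Reduces a n g (h.total (r, ξ, η) : ℤ × ℤ → ℂ_[p])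
      (basisComb n (fun i => resMap a g (r i)) + redDx n (resMap a g ⟨s, h.mem⟩) qξ
        + redDy (resMap a g ⟨s, h.mem⟩) qη) := by
  rw [h.total_apply]
  exact ((reduces_sum_epsTilde r).add (h.reduces_opX hξ)).add (h.reduces_opY hη)

theorem reduces_sub {c c' : C0 p a n g} {q q' : MvPolynomial (Fin 3) (ResRing a g)}
    (h : Reduces a n g (c : ℤ × ℤ → ℂ_[p]) q) (h' : Reduces a n g (c' : ℤ × ℤ → ℂ_[p]) q') :
    Reduces a n g ((c - c' : C0 p a n g) : ℤ × ℤ → ℂ_[p]) (q - q') := by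
  intro u
  obtain ⟨r, hr, e⟩ := h u
  obtain ⟨r', hr', e'⟩ := h' u
  refine ⟨r - r', ?_, by rw [map_sub, e, e', coeff_sub]⟩
  rw [Submodule.coe_sub, Pi.sub_apply, hr, hr', AddSubgroupClass.coe_sub]
  ring

theorem reduces_add {c c' : C0 p a n g} {q q' : MvPolynomial (Fin 3) (ResRing a g)}
    (h : Reduces a n g (c : ℤ × ℤ → ℂ_[p]) q) (h' : Reduces a n g (c' : ℤ × ℤ → ℂ_[p]) q') :
    Reduces a n g ((c + c' : C0 p a n g) : ℤ × ℤ → ℂ_[p]) (q + q') :=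
  h.add h'

theorem exists_eq_gEl_smul_of_dvd (hu : IsUnif p a g) (hn : 0 < n) {c : C0 p a n g}
    {q : MvPolynomial (Fin 3) (ResRing a g)} (h : Reduces a n g (c : ℤ × ℤ → ℂ_[p]) q)
    (hq : xyz (ResRing a g) ∣ q) : ∃ d : C0 p a n g, c = gEl a g • d :=
  exists_eq_gEl_smul hu hn (h.congr (q' := 0) (by rwa [sub_zero]))

theorem OpData.total_surjective (h : OpData p a n g b s) (hpn : ¬ p ∣ n)
    (hs : IsUnit (resMap a g ⟨s, h.mem⟩)) : Function.Surjective h.total := by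
  have hu := h.isUnif
  refine surjective_of_surjective_mod ((hasSeries_ZqAdjoin hu).pi _ |>.prod
    ((hasSeries_C0 hu h.n_pos).prod (hasSeries_C0 hu h.n_pos))) (isSep_C0 hu) _ fun m => ?_
  obtain ⟨q, hq⟩ := exists_reduces hu h.n_pos m
  obtain ⟨v, qξ, qη, hv⟩ := exists_eq_redDx_add_redDy h.n_pos
    (hu.isUnit_natCast_resRing hpn) hs q
  obtain ⟨ξ, hξ⟩ := exists_reduces_of_polynomial h.n_pos qξ
  obtain ⟨η, hη⟩ := exists_reduces_of_polynomial h.n_pos qη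
  choose r hr using fun i => Ideal.Quotient.mk_surjective (v i)
  have h1 := h.reduces_total (r := r) hξ hη
  have hr' : (fun i => resMap a g (r i)) = v := funext hr
  rw [hr'] at h1
  obtain ⟨d, hd⟩ := exists_eq_gEl_smul_of_dvd hu h.n_pos (reduces_sub hq h1) hv
  exact ⟨(r, ξ, η), d, by rw [← hd]; abel⟩

theorem OpData.eq_zero_of_total_eq_zero (h : OpData p a n g b s) (hpn : ¬ p ∣ n)
    (hs : IsUnit (resMap a g ⟨s, h.mem⟩)) {r : Fin (2 * n + 1) → ZqAdjoin p a g}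
    {ξ η : C0 p a n g} (h0 : h.total (r, ξ, η) = 0) : r = 0 := by
  have hu := h.isUnif
  have := hu.isDomain_resRing
  have hcomm : ∀ m, h.opX (h.opY m) = h.opY (h.opX m) := fun m =>
    LinearMap.congr_fun h.opX_mul_opY m
  refine coeff_eq_zero_of_exact_mod (isSep_ZqAdjoin hu)
    (fun m => eq_zero_of_gEl_smul_eq_zero hu) hcomm (epsTilde p a n g) ?_
    (by rw [← h.total_apply, h0])
  intro r ξ η m hm
  rw [← h.total_apply] at hm
  obtain ⟨qξ, hξ⟩ := exists_reduces hu h.n_pos ξ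
  obtain ⟨qη, hη⟩ := exists_reduces hu h.n_pos η
  have h1 := h.reduces_total (r := r) hξ hη
  rw [hm] at h1
  have h2 := h1.dvd_sub hu (reduces_gEl_smul m)
  rw [sub_zero] at h2
  obtain ⟨hr, qζ, h3, h4⟩ := redD_exact h.n_pos (hu.isUnit_natCast_resRing hpn) hs h2
  obtain ⟨ζ, hζ⟩ := exists_reduces_of_polynomial h.n_pos qζ
  refine ⟨fun i => resMap_eq_zero_iff.1 (congrFun hr i), ζ, ?_⟩
  obtain ⟨ξ', hξ'⟩ := exists_eq_gEl_smul_of_dvd hu h.n_pos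
    (reduces_sub hξ (h.reduces_opY hζ)) h3
  obtain ⟨η', hη'⟩ := exists_eq_gEl_smul_of_dvd hu h.n_pos
    (reduces_add hη (h.reduces_opX hζ)) h4
  exact ⟨ξ', η', by rw [← hξ']; abel, by rw [← hη']; abel⟩

end Differential

/-! ### The top cohomology -/

section TopCohomology

variable {R M ι : Type*} [CommRing R] [AddCommGroup M] [Module R M] [Fintype ι]
  {δx δy : M →ₗ[R] M} {e : ι → M}

theorem exists_basis_H2 (hspan : ∀ m, ∃ (r : ι → R) (ξ η : M), ∑ i, r i • e i + δx ξ + δy η = m)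
    (hzero : ∀ (r : ι → R) (ξ η : M), ∑ i, r i • e i + δx ξ + δy η = 0 → r = 0) :
    ∃ b : Module.Basis ι R (H2 δx δy), ∀ i, b i = Submodule.Quotient.mk (e i) := by
  -- The sign in the witness undoes the sign in `d1`, so the coboundaries are exactly the sums δx ξ
  -- + δy η.
  have hd1 : ∀ ξ η, δx ξ + δy η ∈ LinearMap.range (d1 δx δy) :=
    fun ξ η => ⟨(-η, ξ), by simp [d1]⟩
  have hli : LinearIndependent R fun i => (Submodule.Quotient.mk (e i) : H2 δx δy) := by
    rw [Fintype.linearIndependent_iff]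
    intro r hr i
    have h1 : (LinearMap.range (d1 δx δy)).mkQ (∑ i, r i • e i) = 0 := by
      rw [map_sum]
      simpa using hr
    rw [Submodule.mkQ_apply, Submodule.Quotient.mk_eq_zero] at h1
    obtain ⟨⟨ξ, η⟩, h2⟩ := h1
    refine congrFun (hzero r (-η) ξ ?_) i
    rw [← h2]
    simp [d1]
    abel
  have hsp : ⊤ ≤ Submodule.span R
      (Set.range fun i => (Submodule.Quotient.mk (e i) : H2 δx δy)) := by
    rintro x -
    obtain ⟨m, rfl⟩ := Submodule.Quotient.mk_surjective _ x
    obtain ⟨r, ξ, η, rfl⟩ := hspan m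
    rw [Submodule.mem_span_range_iff_exists_fun]
    refine ⟨r, ?_⟩
    rw [add_assoc, Submodule.Quotient.mk_add, (Submodule.Quotient.mk_eq_zero _).2 (hd1 ξ η),
      add_zero, ← Submodule.mkQ_apply, map_sum]
    rfl
  exact ⟨Module.Basis.mk hli hsp, fun i => Module.Basis.mk_apply hli hsp i⟩

theorem isInternal_option [DecidableEq ι]
    (hspan : ∀ m, ∃ (r : ι → R) (ξ η : M), ∑ i, r i • e i + δx ξ + δy η = m)
    (hzero : ∀ (r : ι → R) (ξ η : M), ∑ i, r i • e i + δx ξ + δy η = 0 → r = 0) :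
    DirectSum.IsInternal (fun o : Option ι =>
      o.elim (LinearMap.range δx ⊔ LinearMap.range δy) (fun i => Submodule.span R {e i})) := by
  set A : Option ι → Submodule R M := fun o =>
    o.elim (LinearMap.range δx ⊔ LinearMap.range δy) (fun i => Submodule.span R {e i}) with hA
  have hsum : ∀ x : DirectSum (Option ι) fun o => A o,
      DirectSum.coeAddMonoidHom A x = (x none : M) + ∑ i, (x (some i) : M) := by
    intro x
    classical
    rw [DirectSum.coeAddMonoidHom_eq_dfinsuppSum, DFinsupp.sum_eq_sum_fintype _ (by simp),
      Fintype.sum_option]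
    rfl
  constructor
  · rw [injective_iff_map_eq_zero]
    intro x hx
    rw [hsum] at hx
    obtain ⟨_, ⟨ξ, rfl⟩, _, ⟨η, rfl⟩, h1⟩ := Submodule.mem_sup.1 (x none).2
    choose r hr using fun i => Submodule.mem_span_singleton.1 (x (some i)).2
    have h0 : r = 0 := hzero r ξ η (by
      rw [← hx, ← h1]
      simp only [hr]
      abel)
    have hsome : ∀ i, (x (some i) : M) = 0 := fun i => by rw [← hr, h0]; simp
    refine DFinsupp.ext fun o => Subtype.ext ?_
    rcases o with _ | i
    · simpa [hsome] using hx
    · exact hsome i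
  · intro m
    obtain ⟨r, ξ, η, rfl⟩ := hspan m
    classical
    refine ⟨DirectSum.of (fun o => A o) none
        ⟨δx ξ + δy η, Submodule.add_mem_sup ⟨ξ, rfl⟩ ⟨η, rfl⟩⟩
      + ∑ i, DirectSum.of (fun o => A o) (some i)
        ⟨r i • e i, Submodule.smul_mem _ _ (Submodule.mem_span_singleton_self _)⟩, ?_⟩
    rw [map_add, map_sum]
    simp only [DirectSum.coeAddMonoidHom_of]
    abel

end TopCohomology

/-- A nonzero Teichmüller lift is a (q-1)-st root of unity, hence already a unit before reduction.
-/
theorem isUnit_resMap_teichmuller {p : ℕ} [Fact p.Prime] {a : ℕ} (ha : 0 < a) (g : ℂ_[p])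
    {t : Fq p a} (ht : t ≠ 0) {s : Zq p a} (hs : IsTeichmuller p a t s) :
    IsUnit (resMap a g ⟨((s : Qq p a) : ℂ_[p]), coe_Zq_mem_ZqAdjoin g s⟩) := by
  have hs0 : s ≠ 0 := by
    rintro rfl
    exact ht (by rw [← hs.1, map_zero])
  have h1 : s ^ (p ^ a - 1) = 1 := by
    refine mul_left_cancel₀ hs0 ?_
    rw [← pow_succ', Nat.sub_add_cancel (Nat.one_le_pow a p (Fact.out : p.Prime).pos), hs.2,
      mul_one]
  refine IsUnit.map _ (IsUnit.of_pow_eq_one (n := p ^ a - 1) (Subtype.ext ?_)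
    (pow_sub_one_pos ha).ne')
  have h2 := congrArg (fun z : Zq p a => ((z : Qq p a) : ℂ_[p])) h1
  simpa using h2

end DworkCohomology

end

/-! ### The main theorem -/

theorem theorem2p7 (p : ℕ) [Fact p.Prime] (hp2 : 2 < p) (n : ℕ) (hn : 0 < n) (hpn : ¬ p ∣ n)
    (a : ℕ) (ha : 0 < a)
    (ζ : ℂ_[p]) (hζ : IsPrimitiveRoot ζ p)
    (γ : ℂ_[p]) (hγ_mem : γ ∈ IntermediateField.adjoin ℚ_[p] {ζ})
    (hγ_zero : HasSum (fun k : ℕ => γ ^ p ^ k / (p : ℂ_[p]) ^ k) 0)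
    (hγ_ord : ‖γ‖ = (p : ℝ) ^ (-(1 / ((p : ℝ) - 1))))
    (g : ℂ_[p]) (hg : g ^ n = γ)
    (t : Fq p a) (ht : t ≠ 0) (s : Zq p a) (hs : IsTeichmuller p a t s) :
    ∃ δx δy : C0 p a n g →ₗ[ZqAdjoin p a g] C0 p a n g,
      -- `D_x` and `D_y` are well-defined operators on `C₀`, and they define a complex
      (∀ ξ, (δx ξ : ℤ × ℤ → ℂ_[p]) = Dx p n γ (s : Qq p a) ξ) ∧
      (∀ ξ, (δy ξ : ℤ × ℤ → ℂ_[p]) = Dy p γ (s : Qq p a) ξ) ∧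
      d1 δx δy ∘ₗ d0 δx δy = 0 ∧
      -- the classes of the `ε̃_i` form a basis of the top cohomology
      (∃ b : Module.Basis (Fin (2 * n + 1)) (ZqAdjoin p a g) (H2 δx δy),
        ∀ i, b i = Submodule.Quotient.mk (epsTilde p a n g i)) ∧
      -- `C₀ = ⨁ ℤ_q[g] ε̃_i ⊕ (D_x C₀ + D_y C₀)`
      DirectSum.IsInternal (fun o : Option (Fin (2 * n + 1)) =>
        o.elim (LinearMap.range δx ⊔ LinearMap.range δy)
          (fun i => Submodule.span (ZqAdjoin p a g) {epsTilde p a n g i})) := by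
  have hγ := norm_pow_sub_one_of_norm_eq hγ_ord
  have hu : IsUnif p a g := isUnif_of_pow_eq_gamma ha hn hg hγ hγ_zero
  have h : OpData p a n g (fun i => gammaSeq p γ i * (p : ℂ_[p]) ^ i) ((s : Qq p a) : ℂ_[p]) := by
    refine ⟨hu, hn, coe_Zq_mem_ZqAdjoin g s, by simp [gammaSeq, hg], fun i => ?_⟩
    obtain ⟨r, hr, e⟩ := exists_gammaSeq_mul_eq hu hg hγ hγ_zero i
    -- `OpData` asks for g^i only, so the surplus g^((n-1)i) of g^(n i) goes into the coefficient.
    refine ⟨r * g ^ ((n - 1) * i), mul_mem hr (pow_mem (self_mem_ZqAdjoin a g) _), ?_⟩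
    have hni : n * i = (n - 1) * i + i := by
      rw [← Nat.succ_mul, Nat.succ_eq_add_one, Nat.sub_add_cancel hn]
    rw [e, hni, pow_add]
    ring
  have hsu := isUnit_resMap_teichmuller ha g ht hs
  have hspan : ∀ m, ∃ (r : Fin (2 * n + 1) → ZqAdjoin p a g) (ξ η : C0 p a n g),
      ∑ i, r i • epsTilde p a n g i + h.opX ξ + h.opY η = m := by
    intro m
    obtain ⟨⟨r, ξ, η⟩, hm⟩ := h.total_surjective hpn hsu m
    exact ⟨r, ξ, η, by rw [← h.total_apply, hm]⟩
  have hzero : ∀ (r : Fin (2 * n + 1) → ZqAdjoin p a g) (ξ η : C0 p a n g),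
      ∑ i, r i • epsTilde p a n g i + h.opX ξ + h.opY η = 0 → r = 0 := fun r ξ η h0 =>
    h.eq_zero_of_total_eq_zero hpn hsu (by rw [h.total_apply, h0])
  refine ⟨h.opX, h.opY, fun ξ => funext fun u => h.opX_apply ξ u,
    fun ξ => funext fun u => h.opY_apply ξ u, ?_, exists_basis_H2 hspan hzero,
    isInternal_option hspan hzero⟩
  refine LinearMap.ext fun m => ?_
  have hcomm : h.opX (h.opY m) = h.opY (h.opX m) := LinearMap.congr_fun h.opX_mul_opY m
  change h.opX (h.opY m) - h.opY (h.opX m) = 0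
  rw [hcomm, sub_self]
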